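/- Let $T>0$, $d\in\mathbb N$, $p\in(1,\infty)$, and let $C_T=C([0,T],\mathbb R^d)$ with the supremum norm. Let $\mathcal P_p(\mathbb R^d)$ be the space of probability measures on $\mathbb R^d$ with finite $p$-th moment, with the $p$-Wasserstein distance $\mathcal W_p$ and its Borel $\sigma$-algebra. Let $b:[0,T]\times\mathbb R^d\times\mathcal P_p(\mathbb R^d)\to\mathbb R^d$ be measurable, such that $\int_0^T|b(t,x,\mu)|\,dt<\infty$ for all $x,\mu$, and such that for some constant $K_b$ $$|b(t,x,\mu)-b(t,x',\mu')|^p\le K_b\big(|x-x'|^p+\mathcal W_p(\mu,\mu')^p\big)\qquad\text{for all } t,x,x',\mu,\mu'.$$ Let $(\Omega,\mathcal A,(\mathcal F_t)_{t\in[0,T]},\mathbb P)$ be a filtered probability space satisfying the usual conditions (right-continuity, and every $\mathbb P$-null set lies in $\mathcal F_0$). Let $(\zeta^i)_{i\ge1}\subset L^p(\Omega,\mathbb R^d)$ be $\mathcal F_0$-measurable and $(W^i)_{i\ge1}$ be $(\mathcal F_t)$-adapted standard $d$-dimensional Brownian motions on $[0,T]$, such that the inputs $(\zeta^i,W^i)_{i\ge1}$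 are independent and identically distributed. Let $(\bar\zeta,\bar W)\in L^p(\Omega,\mathbb R^d\times C_T)$ have the same law as $(\zeta^1,W^1)$ (for instance, be an independent copy of it). For $x=(x^1,\dots,x^N)$ write $L^N(x)=\frac1N\sum_{i=1}^N\delta_{x^i}$. Consider, for $t\in[0,T]$, the particle system $$X^{i,N}_t=\zeta^i+\int_0^t b\big(s,X^{i,N}_s,L^N(X^{(N)}_s)\big)\,ds+W^i_t,\qquad i=1,\dots,N,$$ and the McKean–Vlasov equation $$\bar X_t=\bar\zeta+\int_0^t b\big(s,\bar X_s,\mathcal L(\bar X_s)\big)\,ds+\bar W_t .$$ A solution of the latter is a random variable $\bar X:\Omega\to C_T$ with $\mathcal L(\bar X_s)\in\mathcal P_p(\mathbb R^d)$ for all $s$ that satisfies the equation for all $t$, almost surely; in both equations the integrands are required to be integrable over $[0,T]$. Then: 1. for every $N\ge1$ and every $\omega\in\Omega$ the particle system has exactly one solution $X^{(N)}(\omega)\in (C_T)^N$; and the McKean–Vlasov equation has a solution $\bar X$, unique up to almost sure equality; 2. for every $N\ge 1$, $X^{(N)}$ is $\mathcal A$-measurable and $(\mathcal F_t)$-progressively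 measurable; and $\bar X$ is progressively measurable with respect to every filtration $(\mathcal G_t)_{t\in[0,T]}$ on $(\Omega,\mathcal A,\mathbb P)$ that satisfies the usual conditions and for which $\bar\zeta$ is $\mathcal G_0$-measurable and $\bar W$ is $(\mathcal G_t)$-adapted (in particular with respect to $(\mathcal F_t)$ if $(\bar\zeta,\bar W)$ is so adapted); 3. for $\mathbb P$-almost every $\omega$, $L^N(X^{(N)}(\omega))\to\mathcal L(\bar X)$ weakly in the space of probability measures on $C_T$, as $N\to\infty$. -/

import Mathlib

open MeasureTheory ProbabilityTheory Filter
open scoped ENNReal NNReal Topology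

noncomputable section

namespace MeanField

section WassersteinSpace

variable {E : Type*} [NormedAddCommGroup E] [MeasurableSpace E]

/-- The `p`-Wasserstein distance: the `p`-th root of the infimum of `∬ d(x,y)^p π(dx,dy)` over all
couplings `π` of `μ` and `ν`. -/
def wasserstein (p : ℝ) (μ ν : Measure E) : ℝ≥0∞ :=
  (⨅ π ∈ {π : Measure (E × E) | π.map Prod.fst = μ ∧ π.map Prod.snd = ν},
    ∫⁻ z, edist z.1 z.2 ^ p ∂π) ^ (1 / p)

variable (E) in
/-- The space `𝒫_p(E)` of probability measures on `E` with finite `p`-th moment. -/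
def WassersteinSpace (p : ℝ) : Type _ :=
  {μ : ProbabilityMeasure E // ∫⁻ x, ‖x‖ₑ ^ p ∂(μ : Measure E) < ∞}

/-- The underlying measure of an element of `𝒫_p(E)`. -/
def WassersteinSpace.toMeasure {p : ℝ} (μ : WassersteinSpace E p) : Measure E := μ.1

/-- The Borel σ-algebra of `𝒫_p(E)` for the `p`-Wasserstein distance: it is generated by the sets
that contain a Wasserstein ball around each of their points. -/
instance (p : ℝ) : MeasurableSpace (WassersteinSpace E p) :=
  MeasurableSpace.generateFrom
    {U | ∀ μ ∈ U, ∃ ε : ℝ≥0∞, 0 < ε ∧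
      ∀ ν : WassersteinSpace E p, wasserstein p μ.toMeasure ν.toMeasure < ε → ν ∈ U}

end WassersteinSpace

section Empirical

variable {ι : Type*} [Fintype ι] [Nonempty ι] {E : Type*} [MeasurableSpace E]

/-- The empirical measure `1/N ∑ i, δ_{x i}` of a finite nonempty family of `N` points. -/
def empirical (x : ι → E) : ProbabilityMeasure E :=
  ⟨(Fintype.card ι : ℝ≥0∞)⁻¹ • ∑ i, Measure.dirac (x i), ⟨by
    simp only [Measure.smul_apply, Measure.coe_finsetSum, Finset.sum_apply, measure_univ,
      Finset.sum_const, Finset.card_univ, nsmul_eq_mul, mul_one, smul_eq_mul]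
    exact ENNReal.inv_mul_cancel (by simp) (by simp)⟩⟩

/-- The empirical measure as an element of `𝒫_p(E)`. -/
def empiricalW {E : Type*} [NormedAddCommGroup E] [MeasurableSpace E] [BorelSpace E]
    (p : ℝ) (hp : 0 ≤ p) (x : ι → E) : WassersteinSpace E p :=
  ⟨empirical x, by
    have h (i : ι) : ∫⁻ y, ‖y‖ₑ ^ p ∂(Measure.dirac (x i)) < ∞ := by
      rw [lintegral_dirac' _ (by fun_prop)]
      exact ENNReal.rpow_lt_top_of_nonneg hp (by simp)
    simp only [empirical, ProbabilityMeasure.coe_mk, lintegral_smul_measure,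
      lintegral_finsetSum_measure, smul_eq_mul]
    exact ENNReal.mul_lt_top (by simp [Fintype.card_pos]) (ENNReal.sum_lt_top.2 fun i _ => h i)⟩

end Empirical

/-- The state space `ℝ^d` with its Euclidean norm. -/
abbrev Space (d : ℕ) : Type := EuclideanSpace ℝ (Fin d)

/-- The time interval `[0,T]`. -/
abbrev Time (T : ℝ) : Type := Set.Icc (0 : ℝ) T

/-- Lebesgue measure on `[0,T]`. -/
def timeMeasure (T : ℝ) : Measure (Time T) := (volume : Measure ℝ).comap Subtype.val

/-- The path space `C_T = C([0,T], ℝ^d)`, whose norm is the supremum norm. -/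
abbrev PathSpace (d : ℕ) (T : ℝ) : Type := C(Time T, Space d)

/-- The path space carries its Borel σ-algebra. -/
instance (d : ℕ) (T : ℝ) : MeasurableSpace (PathSpace d T) := borel _

instance (d : ℕ) (T : ℝ) : BorelSpace (PathSpace d T) := ⟨rfl⟩

variable {d : ℕ} {T p : ℝ}

/-- A drift `b : [0,T] × ℝ^d × 𝒫_p(ℝ^d) → ℝ^d`. -/
abbrev Drift (d : ℕ) (T p : ℝ) : Type :=
  Time T → Space d → WassersteinSpace (Space d) p → Space d

/-- The assumptions on the drift: it is measurable, integrable in time, and Lipschitz continuous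
in the space and measure variables, uniformly in time. -/
structure Drift.Admissible (b : Drift d T p) : Prop where
  measurable : Measurable fun z : Time T × Space d × WassersteinSpace (Space d) p =>
    b z.1 z.2.1 z.2.2
  integrable : ∀ x μ, Integrable (fun t => b t x μ) (timeMeasure T)
  lipschitz : ∃ K : ℝ≥0, ∀ t x x' μ μ',
    ‖b t x μ - b t x' μ'‖ₑ ^ p
      ≤ K * (‖x - x'‖ₑ ^ p + wasserstein p μ.toMeasure μ'.toMeasure ^ p)

/-- The path `x` solves `x_t = x₀ + ∫_0^t b(s, x_s, μ_s) ds + γ_t` for every `t ∈ [0,T]`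
(and the integral makes sense). -/
def SolvesODE (b : Drift d T p) (μ : Time T → WassersteinSpace (Space d) p)
    (x₀ : Space d) (γ x : PathSpace d T) : Prop :=
  Integrable (fun s => b s (x s) (μ s)) (timeMeasure T) ∧
    ∀ t, x t = x₀ + (∫ s in Set.Iic t, b s (x s) (μ s) ∂(timeMeasure T)) + γ t

/-- The paths `x i` form a solution of the interacting particle system with drift `b`, initial
data `ζ i` and driving paths `w i`: the measure in the drift is their own empirical measure. -/
def SolvesParticleSystem {ι : Type*} [Fintype ι] [Nonempty ι] (hp : 0 ≤ p) (b : Drift d T p)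
    (ζ : ι → Space d) (w x : ι → PathSpace d T) : Prop :=
  ∀ i, SolvesODE b (fun s => empiricalW p hp fun j => x j s) (ζ i) (w i) (x i)

variable {Ω : Type*} {m : MeasurableSpace Ω}

/-- The random path `X` solves the McKean-Vlasov equation with drift `b` and input `(ζ, W)`:
the time marginals of its law belong to `𝒫_p(ℝ^d)`, and almost surely
`X_t = ζ + ∫_0^t b(s, X_s, Law(X_s)) ds + W_t` for every `t ∈ [0,T]`. -/
structure IsMcKeanVlasovSolution (P : Measure Ω) (b : Drift d T p) (ζ : Ω → Space d)
    (W X : Ω → PathSpace d T) : Prop where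
  measurable : Measurable X
  solves : ∃ μ : Time T → WassersteinSpace (Space d) p,
    (∀ s, (μ s).toMeasure = P.map fun ω => X ω s) ∧
      ∀ᵐ ω ∂P, SolvesODE b μ (ζ ω) (W ω) (X ω)

/-- A standard `d`-dimensional Brownian motion on `[0,T]`, as a random continuous path. -/
structure IsBrownianMotion (P : Measure Ω) (W : Ω → PathSpace d T) : Prop where
  measurable : Measurable W
  start : ∀ᵐ ω ∂P, ∀ t : Time T, (t : ℝ) = 0 → W ω t = 0
  indep : HasIndepIncrements (fun t ω => W ω t) P
  gaussian : ∀ s t : Time T, s ≤ t →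
    P.map (fun ω => W ω t - W ω s)
      = (stdGaussian (Space d)).map fun x => √((t : ℝ) - s) • x

/-- The usual conditions: the filtration is right-continuous, and every `P`-null set belongs to
all of its σ-algebras. -/
def UsualConditions (P : Measure Ω) (ℱ : Filtration (Time T) m) : Prop :=
  ℱ.IsRightContinuous ∧ ∀ s : Set Ω, P s = 0 → ∀ t, MeasurableSet[ℱ t] s

/-- The initial datum `ζ` is measurable at time `0` and the process `W` is adapted. -/
def AdaptedInput (ℱ : Filtration (Time T) m) (ζ : Ω → Space d) (W : Ω → PathSpace d T) : Prop :=
  (∀ t : Time T, (t : ℝ) = 0 → Measurable[ℱ t] ζ) ∧ Adapted ℱ fun t ω => W ω t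

end MeanField

end

noncomputable section

namespace MeanField

/-! ### Elementary inequalities for `p`-th powers. -/

section Auxiliary

/-! Under the uniform distribution on the index set, the law of `i ↦ x i` is the empirical measure
of `x`. Hence, for fixed `ω`, the particle system is itself a McKean–Vlasov equation, posed on a
finite probability space with the random input `i ↦ (ζ i ω, W i ω)` (`solvesParticleSystem_iff`). A
theory of the McKean–Vlasov equation on arbitrary probability spaces, with the noise treated
pathwise, therefore covers both equations.

That theory has two pillars. Existence is Picard iteration in `L^p(Ω; C_T)`
(`exists_isMcKeanVlasovSolution`). Stability (`IsMcKeanVlasovSolution.stability`) compares two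
solutions on one space: their joint law couples their time marginals, so the Wasserstein distance in
the drift is at most the expected path distance, and Grönwall closes the estimate. With equal inputs
up to time `t`, stability gives equality of the solutions up to `t`, whence uniqueness and
adaptedness.

For the convergence, the law of large numbers provides, almost surely, couplings of the uniform
distribution on the indices with `P` under which the inputs become `L^p`-close
(`ae_eventually_exists_coupling`). Pulling both solutions back to the product space carrying such a
coupling, stability makes them `L^p`-close too (`SolvesParticleSystem.lintegral_sub_le`), which
forces weak convergence of their laws. -/

theorem add_add_rpow_le {p : ℝ} (hp : 0 ≤ p) (a b c : ℝ≥0∞) :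
    (a + b + c) ^ p ≤ 3 ^ p * (a ^ p + b ^ p + c ^ p) := by
  have h : a + b + c ≤ 3 * max (max a b) c := by
    calc a + b + c ≤ max (max a b) c + max (max a b) c + max (max a b) c := by
          gcongr
          · exact (le_max_left _ _).trans (le_max_left _ _)
          · exact (le_max_right _ _).trans (le_max_left _ _)
          · exact le_max_right _ _
      _ = 3 * max (max a b) c := by ring
  calc (a + b + c) ^ p ≤ (3 * max (max a b) c) ^ p := ENNReal.rpow_le_rpow h hp
    _ = 3 ^ p * (max (max a b) c) ^ p := ENNReal.mul_rpow_of_nonneg _ _ hp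
    _ ≤ _ := by
      gcongr
      rcases max_choice (max a b) c with h | h <;> rw [h]
      · rcases max_choice a b with h | h <;> rw [h]
        · exact le_self_add.trans le_self_add
        · exact le_add_self.trans le_self_add
      · exact le_add_self

/-- Hölder's inequality against the constant `1`; the measure is not normalised, so its mass enters
with exponent `p - 1`. -/
theorem lintegral_enorm_rpow_le {α E : Type*} [MeasurableSpace α] [NormedAddCommGroup E]
    {μ : Measure α} {p : ℝ} (hp : 1 ≤ p) {g : α → E} (hg : AEStronglyMeasurable g μ) :
    (∫⁻ x, ‖g x‖ₑ ∂μ) ^ p ≤ μ Set.univ ^ (p - 1) * ∫⁻ x, ‖g x‖ₑ ^ p ∂μ := by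
  have hp0 : 0 < p := by linarith
  have h := eLpNorm'_le_eLpNorm'_mul_rpow_measure_univ (μ := μ) one_pos hp hg
  simp only [eLpNorm', ENNReal.rpow_one, one_div, inv_one] at h
  refine (ENNReal.rpow_le_rpow h hp0.le).trans_eq ?_
  rw [ENNReal.mul_rpow_of_nonneg _ _ hp0.le, ← ENNReal.rpow_mul, ← ENNReal.rpow_mul,
    inv_mul_cancel₀ hp0.ne', ENNReal.rpow_one, mul_comm]
  congr 2
  field_simp

theorem add_rpow_le {p : ℝ} (hp : 0 < p) (a b : ℝ≥0∞) :
    (a + b) ^ p ≤ 3 ^ p * (a ^ p + b ^ p) := by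
  simpa [hp] using add_add_rpow_le hp.le a b 0

end Auxiliary

/-! ### Integration over the time interval and Grönwall's inequality. -/

section Time

variable {T : ℝ}

instance : IsFiniteMeasure (timeMeasure T) := by
  refine ⟨?_⟩
  rw [timeMeasure, (MeasurableEmbedding.subtype_coe measurableSet_Icc).comap_apply]
  refine (measure_mono (Set.image_subset_iff.2 fun x _ => x.2)).trans_lt
    (measure_Icc_lt_top (a := 0) (b := T))

theorem timeMeasure_le (s : Set (Time T)) : timeMeasure T s ≤ ENNReal.ofReal T := by
  rw [timeMeasure, (MeasurableEmbedding.subtype_coe measurableSet_Icc).comap_apply]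
  refine (measure_mono (t := Set.Icc 0 T) ?_).trans (by simp)
  rintro _ ⟨x, _, rfl⟩
  exact x.2

instance : NullSingletonClass (timeMeasure T) := by
  refine ⟨fun x => ?_⟩
  rw [timeMeasure, (MeasurableEmbedding.subtype_coe measurableSet_Icc).comap_apply]
  simp

theorem setLIntegral_Iic_timeMeasure (t : Time T) (f : ℝ → ℝ≥0∞) :
    ∫⁻ s in Set.Iic t, f s ∂(timeMeasure T) = ∫⁻ u in Set.Icc 0 (t : ℝ), f u := by
  have he := MeasurableEmbedding.subtype_coe (measurableSet_Icc (a := (0 : ℝ)) (b := T))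
  have h : (Set.Iic t : Set (Time T)) = Subtype.val ⁻¹' Set.Icc 0 (t : ℝ) := by
    ext s
    simp [← Subtype.coe_le_coe, s.2.1]
  rw [h, ← he.lintegral_map, timeMeasure, ← he.restrict_map, he.map_comap,
    Measure.restrict_restrict measurableSet_Icc]
  congr 2
  ext u
  simp only [Subtype.range_coe_subtype, Set.mem_Icc, Set.mem_inter_iff, Set.mem_ofPred_eq]
  constructor
  · exact fun h => h.1
  · exact fun h => ⟨h, h.1, h.2.trans t.2.2⟩

/-- The exponential weight `exp (2 C t)`. -/
def expWeight (C : ℝ≥0) (t : Time T) : ℝ≥0∞ := ENNReal.ofReal (Real.exp (2 * C * t))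

theorem expWeight_ne_top (C : ℝ≥0) (t : Time T) : expWeight C t ≠ ∞ := ENNReal.ofReal_ne_top

theorem expWeight_ne_zero (C : ℝ≥0) (t : Time T) : expWeight C t ≠ 0 := by
  simp [expWeight, Real.exp_pos]

theorem one_le_expWeight (C : ℝ≥0) (t : Time T) : 1 ≤ expWeight C t := by
  rw [expWeight, ENNReal.one_le_ofReal]
  exact Real.one_le_exp (mul_nonneg (by positivity) t.2.1)

theorem expWeight_le (C : ℝ≥0) (t : Time T) :
    expWeight C t ≤ ENNReal.ofReal (Real.exp (2 * C * T)) := by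
  have := t.2.2
  unfold expWeight
  gcongr

/-- The left side equals `(exp (2 C t) - 1) / 2`. Doubling the rate in the weight makes `C ∫` a
halving operation in the weighted supremum norm; Grönwall and the Picard iteration both rest on
this. -/
theorem mul_setLIntegral_expWeight_le (C : ℝ≥0) (t : Time T) :
    C * ∫⁻ s in Set.Iic t, expWeight C s ∂(timeMeasure T) ≤ 2⁻¹ * expWeight C t := by
  rcases eq_or_ne C 0 with rfl | hC
  · simp
  have hC' : (0 : ℝ) < C := by positivity
  have ht : (0 : ℝ) ≤ t := t.2.1
  unfold expWeight
  rw [setLIntegral_Iic_timeMeasure t (fun s => ENNReal.ofReal (Real.exp (2 * C * s))),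
    ← ofReal_integral_eq_lintegral_ofReal
      ((by fun_prop : Continuous fun s : ℝ => Real.exp (2 * C * s)).integrableOn_Icc)
      (Eventually.of_forall fun s => (Real.exp_pos _).le),
    integral_Icc_eq_integral_Ioc, ← intervalIntegral.integral_of_le ht,
    intervalIntegral.integral_comp_mul_left (fun s => Real.exp s) (by positivity)]
  rw [integral_exp, ← ENNReal.ofReal_coe_nnreal, ← ENNReal.ofReal_mul hC'.le,
    (by simp : (2⁻¹ : ℝ≥0∞) = ENNReal.ofReal 2⁻¹), ← ENNReal.ofReal_mul (by norm_num)]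
  apply ENNReal.ofReal_le_ofReal
  simp only [mul_zero, Real.exp_zero, smul_eq_mul]
  field_simp
  linarith

theorem mul_setLIntegral_le_of_le_expWeight {C : ℝ≥0} {f : Time T → ℝ≥0∞} {M : ℝ≥0∞} {t : Time T}
    (h : ∀ s ≤ t, f s ≤ M * expWeight C s) :
    C * ∫⁻ s in Set.Iic t, f s ∂(timeMeasure T) ≤ 2⁻¹ * M * expWeight C t := by
  have hm : Measurable (expWeight C : Time T → ℝ≥0∞) := by
    unfold expWeight; fun_prop
  calc C * ∫⁻ s in Set.Iic t, f s ∂(timeMeasure T)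
      ≤ C * ∫⁻ s in Set.Iic t, M * expWeight C s ∂(timeMeasure T) := by
        exact mul_le_mul_right (setLIntegral_mono' measurableSet_Iic h) _
    _ = M * (C * ∫⁻ s in Set.Iic t, expWeight C s ∂(timeMeasure T)) := by
        rw [lintegral_const_mul _ hm]; ring
    _ ≤ M * (2⁻¹ * expWeight C t) := by
        exact mul_le_mul_right (mul_setLIntegral_expWeight_le C t) _
    _ = _ := by ring

/-- The weighted supremum `m` of `f` satisfies `m ≤ a + m / 2`. The a priori bound `M` is
indispensable: it excludes `m = ∞`, so that the half can be absorbed. No measurability of `f`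
enters. -/
theorem ennreal_gronwall (C : ℝ≥0) {f : Time T → ℝ≥0∞} {a M : ℝ≥0∞} (hM : M ≠ ∞) {t₀ : Time T}
    (hfM : ∀ t ≤ t₀, f t ≤ M)
    (h : ∀ t ≤ t₀, f t ≤ a + C * ∫⁻ s in Set.Iic t, f s ∂(timeMeasure T)) :
    f t₀ ≤ ENNReal.ofReal (2 * Real.exp (2 * C * T)) * a := by
  set m : ℝ≥0∞ := ⨆ s ∈ Set.Iic t₀, f s / expWeight C s with hm
  have hfm : ∀ s ≤ t₀, f s ≤ m * expWeight C s := fun s hs =>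
    (ENNReal.div_le_iff (expWeight_ne_zero C s) (expWeight_ne_top C s)).1
      (le_iSup₂ (f := fun s (_ : s ∈ Set.Iic t₀) => f s / expWeight C s) s hs)
  have hmM : m ≤ M := iSup₂_le fun s hs =>
    (ENNReal.div_le_of_le_mul ((hfM s hs).trans
      (le_mul_of_one_le_right' (one_le_expWeight C s))))
  have hm2 : m ≤ a + 2⁻¹ * m := iSup₂_le fun s hs => by
    refine ENNReal.div_le_of_le_mul ((h s hs).trans ?_)
    rw [add_mul]
    refine add_le_add ?_ ?_
    · exact le_mul_of_one_le_right' (one_le_expWeight C s)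
    · exact mul_setLIntegral_le_of_le_expWeight fun r hr => hfm r (hr.trans hs)
  have hm3 : m ≤ 2 * a := by
    rcases eq_or_ne a ∞ with rfl | ha
    · simp
    clear_value m
    lift m to ℝ≥0 using ne_top_of_le_ne_top hM hmM
    lift a to ℝ≥0 using ha
    have : (m : ℝ) ≤ a + 2⁻¹ * m := by
      have := ENNReal.toReal_mono (by finiteness) hm2
      rw [ENNReal.toReal_add (by finiteness) (by finiteness), ENNReal.toReal_mul] at this
      simpa using this
    have h2 : (m : ℝ) ≤ 2 * a := by linarith
    exact_mod_cast h2
  calc f t₀ ≤ m * expWeight C t₀ := hfm t₀ le_rfl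
    _ ≤ (2 * a) * ENNReal.ofReal (Real.exp (2 * C * T)) := by
      gcongr; exact expWeight_le C t₀
    _ = _ := by rw [ENNReal.ofReal_mul (by norm_num)]; simp; ring

end Time

/-! ### Stopped paths and running suprema. -/

section Stop

variable {d : ℕ} {T : ℝ}

/-- The path `x` stopped at time `t`. -/
def stopAt (t : Time T) (x : PathSpace d T) : PathSpace d T :=
  x.comp ⟨fun s => min s t, by fun_prop⟩

@[simp]
theorem stopAt_apply (t : Time T) (x : PathSpace d T) (s : Time T) : stopAt t x s = x (min s t) := rfl

theorem stopAt_sub (t : Time T) (x y : PathSpace d T) : stopAt t (x - y) = stopAt t x - stopAt t y := rfl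

theorem stopAt_stopAt (t : Time T) (x : PathSpace d T) : stopAt t (stopAt t x) = stopAt t x := by
  ext1 s; simp

/-- The final time `T`. -/
def finalTime (hT : 0 ≤ T) : Time T := ⟨T, Set.right_mem_Icc.2 hT⟩

theorem stopAt_finalTime (hT : 0 ≤ T) (x : PathSpace d T) : stopAt (finalTime hT) x = x := by
  ext1 s
  rw [stopAt_apply, min_eq_left]
  exact s.2.2

/-- Joint continuity supplies the joint measurability in time and `ω` that Tonelli's theorem
requires. -/
theorem continuous_stopAt_uncurry :
    Continuous fun z : Time T × PathSpace d T => stopAt z.1 z.2 := by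
  refine ContinuousMap.continuous_of_continuous_uncurry _ ?_
  simp only [Function.uncurry_def, stopAt_apply]
  fun_prop

theorem continuous_stopAt (t : Time T) : Continuous (stopAt t : PathSpace d T → PathSpace d T) :=
  continuous_stopAt_uncurry.comp (by fun_prop : Continuous fun x => (t, x))

theorem enorm_path_le_iff [Nonempty (Time T)] {x : PathSpace d T} {c : ℝ≥0∞} :
    ‖x‖ₑ ≤ c ↔ ∀ s, ‖x s‖ₑ ≤ c := by
  induction c with
  | top => simp
  | coe c =>
    simp only [enorm_le_coe]
    simp only [← NNReal.coe_le_coe, coe_nnnorm]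
    exact ContinuousMap.norm_le_of_nonempty x

theorem enorm_apply_le (x : PathSpace d T) (s : Time T) : ‖x s‖ₑ ≤ ‖x‖ₑ :=
  have : Nonempty (Time T) := ⟨s⟩
  enorm_path_le_iff.1 le_rfl s

/-- Running suprema are thus ordinary norms of stopped paths, so estimates up to time `t` need no
separate path space on `[0,t]`. -/
theorem enorm_stopAt_le_iff {t : Time T} {x : PathSpace d T} {c : ℝ≥0∞} :
    ‖stopAt t x‖ₑ ≤ c ↔ ∀ s ≤ t, ‖x s‖ₑ ≤ c := by
  have : Nonempty (Time T) := ⟨t⟩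
  rw [enorm_path_le_iff]
  refine ⟨fun h s hs => ?_, fun h s => h _ (min_le_right s t)⟩
  simpa [hs] using h s

theorem enorm_stopAt_le (t : Time T) (x : PathSpace d T) : ‖stopAt t x‖ₑ ≤ ‖x‖ₑ :=
  enorm_stopAt_le_iff.2 fun s _ => enorm_apply_le x s

theorem enorm_stopAt_mono {s t : Time T} (hst : s ≤ t) (x : PathSpace d T) :
    ‖stopAt s x‖ₑ ≤ ‖stopAt t x‖ₑ :=
  enorm_stopAt_le_iff.2 fun r hr => enorm_stopAt_le_iff.1 le_rfl r (hr.trans hst)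

theorem enorm_apply_le_stopAt (x : PathSpace d T) (s : Time T) : ‖x s‖ₑ ≤ ‖stopAt s x‖ₑ :=
  enorm_stopAt_le_iff.1 le_rfl s le_rfl

/-- The pathwise estimate for a path that is the sum of a constant, a primitive and a driving
path. -/
theorem enorm_stopAt_rpow_le {p : ℝ} (hp : 1 ≤ p) {z γ : PathSpace d T} {z₀ : Space d}
    {g : Time T → Space d} (hg : Integrable g (timeMeasure T))
    (h : ∀ t, z t = z₀ + (∫ s in Set.Iic t, g s ∂(timeMeasure T)) + γ t) (t : Time T) :
    ‖stopAt t z‖ₑ ^ p ≤ 3 ^ p * (‖z₀‖ₑ ^ p + ‖stopAt t γ‖ₑ ^ p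
      + ENNReal.ofReal T ^ (p - 1) * ∫⁻ s in Set.Iic t, ‖g s‖ₑ ^ p ∂(timeMeasure T)) := by
  have h1 : ‖stopAt t z‖ₑ ≤ ‖z₀‖ₑ + ‖stopAt t γ‖ₑ + ∫⁻ s in Set.Iic t, ‖g s‖ₑ ∂(timeMeasure T) := by
    refine enorm_stopAt_le_iff.2 fun r hr => ?_
    rw [h r, add_right_comm]
    refine (enorm_add_le _ _).trans (add_le_add ((enorm_add_le _ _).trans (add_le_add le_rfl
      (enorm_stopAt_le_iff.1 le_rfl r hr))) ?_)
    exact (enorm_integral_le_lintegral_enorm _).trans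
      (lintegral_mono_set (Set.Iic_subset_Iic.2 hr))
  refine (ENNReal.rpow_le_rpow h1 (by linarith)).trans
    ((add_add_rpow_le (by linarith) _ _ _).trans ?_)
  gcongr 3 ^ p * (_ + ?_)
  refine (lintegral_enorm_rpow_le hp hg.aestronglyMeasurable.restrict).trans ?_
  gcongr
  · rw [Measure.restrict_apply_univ]
    exact timeMeasure_le _

end Stop

/-! ### Wasserstein distances bounded by explicit couplings. -/

section Wasserstein

variable {E : Type*} [NormedAddCommGroup E] [MeasurableSpace E]

theorem wasserstein_rpow_le {p : ℝ} (hp : 0 < p) {μ ν : Measure E} {π : Measure (E × E)}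
    (h₁ : π.map Prod.fst = μ) (h₂ : π.map Prod.snd = ν) :
    wasserstein p μ ν ^ p ≤ ∫⁻ z, edist z.1 z.2 ^ p ∂π := by
  rw [wasserstein, ← ENNReal.rpow_mul, one_div, inv_mul_cancel₀ hp.ne', ENNReal.rpow_one]
  exact iInf₂_le (f := fun (π : Measure (E × E))
    (_ : π ∈ {π : Measure (E × E) | π.map Prod.fst = μ ∧ π.map Prod.snd = ν}) =>
    ∫⁻ z, edist z.1 z.2 ^ p ∂π) π ⟨h₁, h₂⟩

theorem wasserstein_map_rpow_le {Ω : Type*} {m : MeasurableSpace Ω} {P : Measure Ω} {p : ℝ}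
    (hp : 0 < p) {X Y : Ω → E} (hX : Measurable X) (hY : Measurable Y) :
    wasserstein p (P.map X) (P.map Y) ^ p ≤ ∫⁻ ω, ‖X ω - Y ω‖ₑ ^ p ∂P := by
  refine (wasserstein_rpow_le hp (π := P.map fun ω => (X ω, Y ω)) ?_ ?_).trans ?_
  · rw [Measure.map_map measurable_fst (hX.prodMk hY)]; rfl
  · rw [Measure.map_map measurable_snd (hX.prodMk hY)]; rfl
  · refine (lintegral_map_le _ _).trans_eq ?_
    simp only [edist_eq_enorm_sub]

theorem wasserstein_self_rpow {p : ℝ} (hp : 0 < p) (μ : Measure E) :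
    wasserstein p μ μ ^ p = 0 := by
  have h := wasserstein_map_rpow_le (P := μ) hp measurable_id measurable_id
  simpa [hp] using h

end Wasserstein

variable {d : ℕ} {T p : ℝ}

/-! ### Pathwise estimates. -/

section Path

/-- The Lipschitz condition on a drift, with constant `K`. -/
def Drift.LipschitzBound (b : Drift d T p) (K : ℝ≥0) : Prop :=
  ∀ t x x' μ μ', ‖b t x μ - b t x' μ'‖ₑ ^ p
      ≤ K * (‖x - x'‖ₑ ^ p + wasserstein p μ.toMeasure μ'.toMeasure ^ p)

/-- The path `x` is `x_t = x₀ + ∫_0^t b(s, y_s, μ_s) ds + γ_t`. -/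
def IsDrivenBy (b : Drift d T p) (μ : Time T → WassersteinSpace (Space d) p)
    (x₀ : Space d) (γ y x : PathSpace d T) : Prop :=
  Integrable (fun s => b s (y s) (μ s)) (timeMeasure T) ∧
    ∀ t, x t = x₀ + (∫ s in Set.Iic t, b s (y s) (μ s) ∂(timeMeasure T)) + γ t

theorem SolvesODE.isDrivenBy {b : Drift d T p} {μ : Time T → WassersteinSpace (Space d) p}
    {x₀ : Space d} {γ x : PathSpace d T} (h : SolvesODE b μ x₀ γ x) :
    IsDrivenBy b μ x₀ γ x x := h

/-- The difference of two such paths is again a constant plus a primitive plus a driving path.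
Keeping the path `y` in the drift apart from `x` lets one estimate serve both solutions (`y = x`)
and Picard steps. -/
theorem IsDrivenBy.enorm_stopAt_sub_rpow_le {b : Drift d T p} {K : ℝ≥0} (hp : 1 ≤ p)
    (hK : b.LipschitzBound K) {μ μ' : Time T → WassersteinSpace (Space d) p}
    {x₀ x₀' : Space d} {γ γ' y y' x x' : PathSpace d T} (h : IsDrivenBy b μ x₀ γ y x)
    (h' : IsDrivenBy b μ' x₀' γ' y' x') (t : Time T) :
    ‖stopAt t (x - x')‖ₑ ^ p ≤ 3 ^ p * (‖x₀ - x₀'‖ₑ ^ p + ‖stopAt t (γ - γ')‖ₑ ^ p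
      + ENNReal.ofReal T ^ (p - 1) * ∫⁻ s in Set.Iic t, K * (‖y s - y' s‖ₑ ^ p
        + wasserstein p (μ s).toMeasure (μ' s).toMeasure ^ p) ∂(timeMeasure T)) := by
  refine (enorm_stopAt_rpow_le hp (h.1.sub h'.1) (z₀ := x₀ - x₀') (γ := γ - γ') ?_ t).trans ?_
  · intro r
    simp only [ContinuousMap.sub_apply, Pi.sub_apply]
    rw [integral_sub h.1.integrableOn h'.1.integrableOn, h.2 r, h'.2 r]
    abel
  · gcongr with s
    exact hK s _ _ _ _

/-- The constant in the integral inequalities for solutions. -/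
def growthConst (p T : ℝ) (K : ℝ≥0) : ℝ≥0 := 2 * 3 ^ p * T.toNNReal ^ (p - 1) * K

theorem coe_growthConst (hp : 1 ≤ p) (K : ℝ≥0) : (growthConst p T K : ℝ≥0∞) =
    2 * 3 ^ p * ENNReal.ofReal T ^ (p - 1) * K := by
  simp only [growthConst, ENNReal.coe_mul, ENNReal.ofReal]
  rw [ENNReal.coe_rpow_of_nonneg _ (by linarith), ENNReal.coe_rpow_of_nonneg _ (by linarith)]
  rfl

/-- The constant in the stability estimate. -/
def stabilityConst (p T : ℝ) (K : ℝ≥0) : ℝ≥0∞ :=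
  ENNReal.ofReal (2 * Real.exp (2 * growthConst p T K * T)) * 3 ^ p

theorem stabilityConst_ne_top (hp : 0 ≤ p) (K : ℝ≥0) : stabilityConst p T K ≠ ∞ :=
  ENNReal.mul_ne_top ENNReal.ofReal_ne_top (ENNReal.rpow_ne_top_of_nonneg hp (by simp))

/-- Two solutions of the equation with the same flow of measures. -/
theorem SolvesODE.enorm_sub_rpow_le {b : Drift d T p} {K : ℝ≥0} (hp : 1 ≤ p) (hT : 0 ≤ T)
    (hK : b.LipschitzBound K) {μ : Time T → WassersteinSpace (Space d) p}
    {x₀ x₀' : Space d} {γ γ' x x' : PathSpace d T} (h : SolvesODE b μ x₀ γ x)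
    (h' : SolvesODE b μ x₀' γ' x') :
    ‖x - x'‖ₑ ^ p ≤ stabilityConst p T K * (‖x₀ - x₀'‖ₑ ^ p + ‖γ - γ'‖ₑ ^ p) := by
  have hp0 : 0 < p := by linarith
  rw [← stopAt_finalTime hT (x - x'), stabilityConst, mul_assoc]
  refine ennreal_gronwall _ (f := fun t => ‖stopAt t (x - x')‖ₑ ^ p) (M := ‖x - x'‖ₑ ^ p)
    (ENNReal.rpow_ne_top_of_nonneg hp0.le (by simp)) (fun t _ => ?_) fun t _ => ?_
  · gcongr
    exact enorm_stopAt_le t _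
  · refine (h.isDrivenBy.enorm_stopAt_sub_rpow_le hp hK h'.isDrivenBy t).trans ?_
    rw [mul_add, coe_growthConst hp]
    refine add_le_add ?_ ?_
    · gcongr
      exact enorm_stopAt_le t _
    · calc 3 ^ p * (ENNReal.ofReal T ^ (p - 1) * ∫⁻ s in Set.Iic t, K * (‖x s - x' s‖ₑ ^ p
            + wasserstein p (μ s).toMeasure (μ s).toMeasure ^ p) ∂(timeMeasure T))
          ≤ 3 ^ p * (ENNReal.ofReal T ^ (p - 1) * ∫⁻ s in Set.Iic t, K *
            ‖stopAt s (x - x')‖ₑ ^ p ∂(timeMeasure T)) := by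
            gcongr with s
            rw [wasserstein_self_rpow hp0, add_zero]
            gcongr
            exact enorm_apply_le_stopAt (x - x') s
        _ = 1 * 3 ^ p * ENNReal.ofReal T ^ (p - 1) * K * ∫⁻ s in Set.Iic t,
            ‖stopAt s (x - x')‖ₑ ^ p ∂(timeMeasure T) := by
            rw [lintegral_const_mul' _ _ (by simp)]; ring
        -- With a common flow of measures the Wasserstein term is zero; a factor `2` is given away
        -- to share the constant of the McKean–Vlasov case.
        _ ≤ _ := by
            gcongr
            exact one_le_two

end Path

/-! ### Moment bounds and stability for the McKean–Vlasov equation. -/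

section Random

variable {Ω : Type*} {m : MeasurableSpace Ω} {P : Measure Ω}

theorem measurable_enorm_stopAt {X : Ω → PathSpace d T} (hX : Measurable X) :
    Measurable fun z : Time T × Ω => ‖stopAt z.1 (X z.2)‖ₑ :=
  (continuous_stopAt_uncurry.measurable.comp
    (measurable_fst.prodMk (hX.comp measurable_snd))).enorm

theorem measurable_eval {X : Ω → PathSpace d T} (hX : Measurable X) (s : Time T) :
    Measurable fun ω => X ω s :=
  (continuous_eval_const (F := PathSpace d T) s).measurable.comp hX

/-- The joint law of `Y` and `Y'` at time `s` couples the two marginals, so the Wasserstein term is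
at most the expected running distance. Stability is the case `X = Y`, and the Picard contraction the
case where `X` is the image of `Y`. -/
theorem lintegral_enorm_stopAt_sub_le [IsProbabilityMeasure P] {b : Drift d T p} {K : ℝ≥0}
    (hp : 1 ≤ p) (hK : b.LipschitzBound K) {μ μ' : Time T → WassersteinSpace (Space d) p}
    {ζ ζ' : Ω → Space d} {W W' X X' Y Y' : Ω → PathSpace d T}
    (hζ : Measurable ζ) (hζ' : Measurable ζ') (hW : Measurable W) (hW' : Measurable W')
    (hY : Measurable Y) (hY' : Measurable Y')
    (hμ : ∀ s, (μ s).toMeasure = P.map fun ω => Y ω s)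
    (hμ' : ∀ s, (μ' s).toMeasure = P.map fun ω => Y' ω s)
    (h : ∀ᵐ ω ∂P, IsDrivenBy b μ (ζ ω) (W ω) (Y ω) (X ω))
    (h' : ∀ᵐ ω ∂P, IsDrivenBy b μ' (ζ' ω) (W' ω) (Y' ω) (X' ω)) (t : Time T) :
    ∫⁻ ω, ‖stopAt t (X ω - X' ω)‖ₑ ^ p ∂P ≤
      3 ^ p * (∫⁻ ω, ‖ζ ω - ζ' ω‖ₑ ^ p ∂P + ∫⁻ ω, ‖stopAt t (W ω - W' ω)‖ₑ ^ p ∂P)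
      + growthConst p T K * ∫⁻ s in Set.Iic t, ∫⁻ ω, ‖stopAt s (Y ω - Y' ω)‖ₑ ^ p ∂P
        ∂(timeMeasure T) := by
  have hp0 : 0 < p := by linarith
  set D : Time T → ℝ≥0∞ := fun s => ∫⁻ ω, ‖stopAt s (Y ω - Y' ω)‖ₑ ^ p ∂P with hD
  have hF : Measurable fun z : Time T × Ω => ‖stopAt z.1 (Y z.2 - Y' z.2)‖ₑ ^ p :=
    (measurable_enorm_stopAt (hY.sub hY')).pow_const p
  have hDm : Measurable D := hF.lintegral_prod_right'
  have hw (s : Time T) : wasserstein p (μ s).toMeasure (μ' s).toMeasure ^ p ≤ D s := by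
    rw [hμ, hμ']
    refine (wasserstein_map_rpow_le hp0 (measurable_eval hY s) (measurable_eval hY' s)).trans ?_
    refine lintegral_mono fun ω => ?_
    gcongr
    exact enorm_apply_le_stopAt (Y ω - Y' ω) s
  have hpath : ∀ᵐ ω ∂P, ‖stopAt t (X ω - X' ω)‖ₑ ^ p ≤
      3 ^ p * (‖ζ ω - ζ' ω‖ₑ ^ p + ‖stopAt t (W ω - W' ω)‖ₑ ^ p
      + ENNReal.ofReal T ^ (p - 1) * ∫⁻ s in Set.Iic t, K * (‖stopAt s (Y ω - Y' ω)‖ₑ ^ p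
        + D s) ∂(timeMeasure T)) := by
    filter_upwards [h, h'] with ω h h'
    refine (h.enorm_stopAt_sub_rpow_le hp hK h' t).trans ?_
    gcongr with s
    · exact enorm_apply_le_stopAt (Y ω - Y' ω) s
    · exact hw s
  refine (lintegral_mono_ae hpath).trans ?_
  have h3 : (3 : ℝ≥0∞) ^ p ≠ ∞ := ENNReal.rpow_ne_top_of_nonneg hp0.le (by simp)
  have hTp : ENNReal.ofReal T ^ (p - 1) ≠ ∞ :=
    ENNReal.rpow_ne_top_of_nonneg (by linarith) (by simp)
  have hζm : Measurable fun ω => ‖ζ ω - ζ' ω‖ₑ ^ p := (hζ.sub hζ').enorm.pow_const p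
  have hWm : Measurable fun ω => ‖stopAt t (W ω - W' ω)‖ₑ ^ p :=
    ((continuous_stopAt t).measurable.comp (hW.sub hW')).enorm.pow_const p
  have hsum : Measurable fun ω => ‖ζ ω - ζ' ω‖ₑ ^ p + ‖stopAt t (W ω - W' ω)‖ₑ ^ p := hζm.add hWm
  rw [lintegral_const_mul' _ _ h3, lintegral_add_left hsum, lintegral_add_left hζm,
    lintegral_const_mul' _ _ hTp, mul_add, coe_growthConst hp]
  refine add_le_add le_rfl (le_of_eq ?_)
  -- The path term and the Wasserstein term both contribute `D s`: this is the `2` in `growthConst`.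
  have hswap : ∫⁻ ω, ∫⁻ s in Set.Iic t, K * (‖stopAt s (Y ω - Y' ω)‖ₑ ^ p + D s) ∂(timeMeasure T) ∂P
      = ∫⁻ s in Set.Iic t, 2 * K * D s ∂(timeMeasure T) := by
    rw [lintegral_lintegral_swap]
    · refine lintegral_congr fun s => ?_
      rw [lintegral_const_mul' _ _ (by simp), lintegral_add_right _ measurable_const,
        lintegral_const, measure_univ, mul_one]
      change K * (D s + D s) = 2 * K * D s
      ring
    · exact ((hF.comp measurable_swap).add (hDm.comp measurable_snd)).const_mul _ |>.aemeasurable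
  rw [hswap, lintegral_const_mul' _ _ (by finiteness)]
  ring

theorem lintegral_enorm_sub_rpow_lt_top {E : Type*} [NormedAddCommGroup E] [MeasurableSpace E]
    [OpensMeasurableSpace E] (hp : 0 < p) {X Y : Ω → E} (hXm : Measurable X)
    (hX : ∫⁻ ω, ‖X ω‖ₑ ^ p ∂P < ∞) (hY : ∫⁻ ω, ‖Y ω‖ₑ ^ p ∂P < ∞) :
    ∫⁻ ω, ‖X ω - Y ω‖ₑ ^ p ∂P < ∞ := by
  have h3 : (3 : ℝ≥0∞) ^ p ≠ ∞ := ENNReal.rpow_ne_top_of_nonneg hp.le (by simp)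
  calc ∫⁻ ω, ‖X ω - Y ω‖ₑ ^ p ∂P ≤ ∫⁻ ω, 3 ^ p * (‖X ω‖ₑ ^ p + ‖Y ω‖ₑ ^ p) ∂P := by
        refine lintegral_mono fun ω => ?_
        exact (ENNReal.rpow_le_rpow enorm_sub_le hp.le).trans (add_rpow_le hp _ _)
    _ = 3 ^ p * (∫⁻ ω, ‖X ω‖ₑ ^ p ∂P + ∫⁻ ω, ‖Y ω‖ₑ ^ p ∂P) := by
        rw [lintegral_const_mul' _ _ h3, lintegral_add_left (hXm.enorm.pow_const p)]
    _ < ∞ := ENNReal.mul_lt_top h3.lt_top (ENNReal.add_lt_top.2 ⟨hX, hY⟩)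

theorem lintegral_enorm_rpow_const_lt_top {E : Type*} [NormedAddCommGroup E]
    [IsProbabilityMeasure P] (hp : 0 ≤ p) (x : E) : ∫⁻ _ω : Ω, ‖x‖ₑ ^ p ∂P < ∞ := by
  simp only [lintegral_const, measure_univ, mul_one]
  exact ENNReal.rpow_lt_top_of_nonneg hp (by simp)

/-- Solutions of the equation with integrable inputs are integrable. -/
theorem lintegral_enorm_rpow_lt_top_of_solvesODE [IsProbabilityMeasure P] {b : Drift d T p}
    {K : ℝ≥0} (hp : 1 ≤ p) (hT : 0 ≤ T) (hK : b.LipschitzBound K)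
    {μ : Time T → WassersteinSpace (Space d) p} {ζ : Ω → Space d} {W X : Ω → PathSpace d T}
    (hζ : Measurable ζ) (hW : Measurable W) (hX : Measurable X)
    (hζp : ∫⁻ ω, ‖ζ ω‖ₑ ^ p ∂P < ∞) (hWp : ∫⁻ ω, ‖W ω‖ₑ ^ p ∂P < ∞)
    (h : ∀ᵐ ω ∂P, SolvesODE b μ (ζ ω) (W ω) (X ω)) :
    ∫⁻ ω, ‖X ω‖ₑ ^ p ∂P < ∞ := by
  have hp0 : 0 < p := by linarith
  -- All paths solve the equation with the same flow `μ`, so comparison with the single path `X ω₀`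
  -- bounds `X` by the inputs.
  obtain ⟨ω₀, h₀⟩ := h.exists
  have hζ' := lintegral_enorm_sub_rpow_lt_top hp0 hζ hζp
    (lintegral_enorm_rpow_const_lt_top hp0.le (ζ ω₀))
  have hW' := lintegral_enorm_sub_rpow_lt_top hp0 hW hWp
    (lintegral_enorm_rpow_const_lt_top hp0.le (W ω₀))
  have hX' : ∫⁻ ω, ‖X ω - X ω₀‖ₑ ^ p ∂P < ∞ := by
    calc ∫⁻ ω, ‖X ω - X ω₀‖ₑ ^ p ∂P
        ≤ ∫⁻ ω, stabilityConst p T K * (‖ζ ω - ζ ω₀‖ₑ ^ p + ‖W ω - W ω₀‖ₑ ^ p) ∂P := by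
          refine lintegral_mono_ae (h.mono fun ω hω => ?_)
          exact hω.enorm_sub_rpow_le hp hT hK h₀
      _ = stabilityConst p T K *
          (∫⁻ ω, ‖ζ ω - ζ ω₀‖ₑ ^ p ∂P + ∫⁻ ω, ‖W ω - W ω₀‖ₑ ^ p ∂P) := by
          rw [lintegral_const_mul' _ _ (stabilityConst_ne_top hp0.le K),
            lintegral_add_left ((hζ.sub_const _).enorm.pow_const p)]
      _ < ∞ := ENNReal.mul_lt_top (stabilityConst_ne_top hp0.le K).lt_top
          (ENNReal.add_lt_top.2 ⟨hζ', hW'⟩)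
  have := lintegral_enorm_sub_rpow_lt_top hp0 (hX.sub_const _) hX'
    (lintegral_enorm_rpow_const_lt_top hp0.le (-X ω₀))
  simpa using this

/-- A solution is only required to have time marginals in `𝒫_p`. Integrability of the supremum norm
is a consequence, and it provides the finite bound that Grönwall needs. -/
theorem IsMcKeanVlasovSolution.lintegral_lt_top [IsProbabilityMeasure P] {b : Drift d T p}
    {K : ℝ≥0} (hp : 1 ≤ p) (hT : 0 ≤ T) (hK : b.LipschitzBound K)
    {ζ : Ω → Space d} {W X : Ω → PathSpace d T} (hX : IsMcKeanVlasovSolution P b ζ W X)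
    (hζ : Measurable ζ) (hW : Measurable W)
    (hζp : ∫⁻ ω, ‖ζ ω‖ₑ ^ p ∂P < ∞) (hWp : ∫⁻ ω, ‖W ω‖ₑ ^ p ∂P < ∞) :
    ∫⁻ ω, ‖X ω‖ₑ ^ p ∂P < ∞ := by
  obtain ⟨μ, -, h⟩ := hX.solves
  exact lintegral_enorm_rpow_lt_top_of_solvesODE hp hT hK hζ hW hX.measurable hζp hWp h

/-- Stability of solutions of the McKean-Vlasov equation with respect to the inputs, up to a
given time. -/
theorem IsMcKeanVlasovSolution.stability [IsProbabilityMeasure P] {b : Drift d T p}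
    {K : ℝ≥0} (hp : 1 ≤ p) (hK : b.LipschitzBound K)
    {ζ ζ' : Ω → Space d} {W W' X X' : Ω → PathSpace d T}
    (hX : IsMcKeanVlasovSolution P b ζ W X) (hX' : IsMcKeanVlasovSolution P b ζ' W' X')
    (hζ : Measurable ζ) (hζ' : Measurable ζ') (hW : Measurable W) (hW' : Measurable W')
    (hζp : ∫⁻ ω, ‖ζ ω‖ₑ ^ p ∂P < ∞) (hζp' : ∫⁻ ω, ‖ζ' ω‖ₑ ^ p ∂P < ∞)
    (hWp : ∫⁻ ω, ‖W ω‖ₑ ^ p ∂P < ∞) (hWp' : ∫⁻ ω, ‖W' ω‖ₑ ^ p ∂P < ∞) (t : Time T) :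
    ∫⁻ ω, ‖stopAt t (X ω - X' ω)‖ₑ ^ p ∂P ≤ stabilityConst p T K *
      (∫⁻ ω, ‖ζ ω - ζ' ω‖ₑ ^ p ∂P + ∫⁻ ω, ‖stopAt t (W ω - W' ω)‖ₑ ^ p ∂P) := by
  have hp0 : 0 < p := by linarith
  have hT : 0 ≤ T := t.2.1.trans t.2.2
  have hXX := lintegral_enorm_sub_rpow_lt_top hp0 hX.measurable
    (hX.lintegral_lt_top hp hT hK hζ hW hζp hWp) (hX'.lintegral_lt_top hp hT hK hζ' hW' hζp' hWp')
  obtain ⟨μ, hμ, h⟩ := hX.solves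
  obtain ⟨μ', hμ', h'⟩ := hX'.solves
  rw [stabilityConst, mul_assoc]
  refine ennreal_gronwall _ (f := fun s => ∫⁻ ω, ‖stopAt s (X ω - X' ω)‖ₑ ^ p ∂P)
    hXX.ne (fun s _ => ?_) fun s hs => ?_
  · refine lintegral_mono fun ω => ?_
    gcongr
    exact enorm_stopAt_le s _
  · refine (lintegral_enorm_stopAt_sub_le hp hK hζ hζ' hW hW' hX.measurable hX'.measurable hμ hμ'
      h h' s).trans ?_
    gcongr with ω
    exact enorm_stopAt_mono hs _

end Random

section Auxiliary

theorem le_mul_of_rpow_le_mul_rpow {p : ℝ} (hp : 0 < p) {a b c : ℝ≥0∞}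
    (h : a ^ p ≤ c ^ p * b ^ p) : a ≤ c * b := by
  rwa [← ENNReal.mul_rpow_of_nonneg _ _ hp.le, ENNReal.rpow_le_rpow_iff hp] at h

theorem integrable_of_enorm_rpow_le {α E : Type*} [MeasurableSpace α] [NormedAddCommGroup E]
    {μ : Measure α} [IsFiniteMeasure μ] {p : ℝ} (hp : 0 < p) {g : α → E}
    (hg : AEStronglyMeasurable g μ) {c : ℝ≥0∞} (hc : c ≠ ∞) (h : ∀ x, ‖g x‖ₑ ^ p ≤ c) :
    Integrable g μ := by
  refine ⟨hg, ?_⟩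
  have h' : ∀ x, ‖g x‖ₑ ≤ c ^ p⁻¹ := fun x => (ENNReal.le_rpow_inv_iff hp).2 (h x)
  refine (lintegral_mono h').trans_lt ?_
  rw [lintegral_const]
  exact ENNReal.mul_lt_top (ENNReal.rpow_lt_top_of_nonneg (by positivity) hc) (measure_lt_top _ _)

/-- Dominated convergence: at fixed `s`, the indicator of `s ≤ t` is continuous in `t` at `t₀`
unless `s = t₀`, and points are null. -/
theorem continuous_setIntegral_Iic {T : ℝ} {E : Type*} [NormedAddCommGroup E] [NormedSpace ℝ E]
    {g : Time T → E} (hg : Integrable g (timeMeasure T)) :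
    Continuous fun t => ∫ s in Set.Iic t, g s ∂(timeMeasure T) := by
  simp_rw [← integral_indicator measurableSet_Iic]
  refine continuous_iff_continuousAt.2 fun t₀ => ?_
  refine continuousAt_of_dominated (bound := fun s => ‖g s‖) ?_ ?_ hg.norm ?_
  · exact Eventually.of_forall fun t => hg.aestronglyMeasurable.indicator measurableSet_Iic
  · exact Eventually.of_forall fun t => Eventually.of_forall fun s => norm_indicator_le_norm_self _ _
  · have hne : ∀ᵐ s ∂(timeMeasure T), s ≠ t₀ := by
      rw [ae_iff]
      simp
    filter_upwards [hne] with s hs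
    rcases lt_or_gt_of_ne hs with hs | hs
    · refine (continuousAt_const (y := g s)).congr ?_
      filter_upwards [lt_mem_nhds hs] with t ht
      rw [Set.indicator_of_mem (Set.mem_Iic.2 ht.le)]
    · refine (continuousAt_const (y := 0)).congr ?_
      filter_upwards [gt_mem_nhds hs] with t ht
      rw [Set.indicator_of_notMem (by simpa using ht)]

theorem memLp_ofReal_iff {Ω : Type*} {m : MeasurableSpace Ω} {P : Measure Ω} {p : ℝ}
    {E : Type*} [NormedAddCommGroup E] [MeasurableSpace E] [BorelSpace E]
    [SecondCountableTopology E] (hp : 0 < p) {X : Ω → E} (hX : Measurable X) :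
    MemLp X (ENNReal.ofReal p) P ↔ ∫⁻ ω, ‖X ω‖ₑ ^ p ∂P < ∞ := by
  rw [MemLp, and_iff_right hX.aestronglyMeasurable,
    eLpNorm_lt_top_iff_lintegral_rpow_enorm_lt_top (by simpa using hp) (by simp),
    ENNReal.toReal_ofReal hp.le]

theorem edist_Lp_rpow {Ω : Type*} {m : MeasurableSpace Ω} {P : Measure Ω} {p : ℝ}
    {E : Type*} [NormedAddCommGroup E] (hp : 0 < p)
    (f g : Lp E (ENNReal.ofReal p) P) :
    edist f g ^ p = ∫⁻ ω, ‖f ω - g ω‖ₑ ^ p ∂P := by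
  rw [Lp.edist_def, eLpNorm_eq_lintegral_rpow_enorm_toReal (by simpa using hp) (by simp),
    ENNReal.toReal_ofReal hp.le, ← ENNReal.rpow_mul, one_div, inv_mul_cancel₀ hp.ne',
    ENNReal.rpow_one]
  rfl

end Auxiliary

variable {d : ℕ} {T p : ℝ}

theorem enorm_stopAt_zero (t : Time T) : ‖stopAt t (0 : PathSpace d T)‖ₑ = 0 :=
  nonpos_iff_eq_zero.1 (enorm_stopAt_le_iff.2 fun s _ => by simp)

/-! ### The integral operator of the drift. -/

section Primitive

/-- The path `t ↦ ∫_0^t b(s, y_s, μ_s) ds`. -/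
def primitivePath (b : Drift d T p) {μ : Time T → WassersteinSpace (Space d) p}
    (h : ∀ y : PathSpace d T, Integrable (fun s => b s (y s) (μ s)) (timeMeasure T))
    (y : PathSpace d T) : PathSpace d T :=
  ⟨fun t => ∫ s in Set.Iic t, b s (y s) (μ s) ∂(timeMeasure T), continuous_setIntegral_Iic (h y)⟩

/-- The pathwise estimate with zero inputs and a common flow gives a Lipschitz bound. Continuity in
`y` makes the Picard image of a random path measurable. -/
theorem continuous_primitivePath {b : Drift d T p} {K : ℝ≥0} (hT : 0 ≤ T) (hp : 1 ≤ p)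
    (hK : b.LipschitzBound K)
    {μ : Time T → WassersteinSpace (Space d) p}
    (h : ∀ y : PathSpace d T, Integrable (fun s => b s (y s) (μ s)) (timeMeasure T)) :
    Continuous (primitivePath b h) := by
  have hp0 : 0 < p := by linarith
  set C : ℝ≥0∞ := 3 ^ p * (ENNReal.ofReal T ^ (p - 1) * (K * ENNReal.ofReal T)) with hC
  have hCtop : C ≠ ∞ := by
    refine ENNReal.mul_ne_top (ENNReal.rpow_ne_top_of_nonneg hp0.le (by simp))
      (ENNReal.mul_ne_top (ENNReal.rpow_ne_top_of_nonneg (by linarith) (by simp)) (by finiteness))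
  have hC' : C ^ p⁻¹ ≠ ∞ := ENNReal.rpow_ne_top_of_nonneg (by positivity) hCtop
  refine LipschitzWith.continuous (K := (C ^ p⁻¹).toNNReal) fun y y' => ?_
  rw [ENNReal.coe_toNNReal hC', edist_eq_enorm_sub, edist_eq_enorm_sub]
  refine le_mul_of_rpow_le_mul_rpow hp0 ?_
  rw [← ENNReal.rpow_mul, inv_mul_cancel₀ hp0.ne', ENNReal.rpow_one]
  have hd (y : PathSpace d T) : IsDrivenBy b μ 0 0 y (primitivePath b h y) :=
    ⟨h y, fun t => by simp [primitivePath]⟩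
  have := (hd y).enorm_stopAt_sub_rpow_le hp hK (hd y') (finalTime hT)
  rw [stopAt_finalTime, sub_self, sub_self, enorm_stopAt_zero, enorm_zero, ENNReal.zero_rpow_of_pos hp0,
    zero_add, zero_add] at this
  refine this.trans ?_
  rw [hC, mul_assoc, mul_assoc]
  gcongr
  calc ∫⁻ s in Set.Iic (finalTime hT), K * (‖y s - y' s‖ₑ ^ p
            + wasserstein p (μ s).toMeasure (μ s).toMeasure ^ p) ∂(timeMeasure T)
      ≤ ∫⁻ s in Set.Iic (finalTime hT), K * ‖y - y'‖ₑ ^ p ∂(timeMeasure T) := by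
        gcongr with s
        rw [wasserstein_self_rpow hp0, add_zero]
        gcongr
        exact enorm_apply_le (y - y') s
    _ ≤ K * ‖y - y'‖ₑ ^ p * ENNReal.ofReal T := by
        rw [lintegral_const, Measure.restrict_apply_univ]
        gcongr
        exact timeMeasure_le _
    _ = _ := by ring

end Primitive

/-! ### The flow of time marginals. -/

section LawFlow

variable {Ω : Type*} {m : MeasurableSpace Ω}

/-- The flow of the time marginals of the law of a random path with finite `p`-th moment. -/
def lawFlow (P : Measure Ω) [IsProbabilityMeasure P] (hp : 0 ≤ p) {X : Ω → PathSpace d T}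
    (hX : Measurable X) (h : ∫⁻ ω, ‖X ω‖ₑ ^ p ∂P < ∞) :
    Time T → WassersteinSpace (Space d) p := fun s =>
  ⟨⟨P.map fun ω => X ω s, Measure.isProbabilityMeasure_map (measurable_eval hX s).aemeasurable⟩, by
    rw [ProbabilityMeasure.coe_mk, lintegral_map (by fun_prop) (measurable_eval hX s)]
    refine lt_of_le_of_lt (lintegral_mono fun ω => ?_) h
    exact ENNReal.rpow_le_rpow (enorm_apply_le _ _) hp⟩

variable {P : Measure Ω} [IsProbabilityMeasure P] {X : Ω → PathSpace d T}

theorem tendsto_lintegral_enorm_sub (hp : 0 < p) (hX : Measurable X)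
    (h : ∫⁻ ω, ‖X ω‖ₑ ^ p ∂P < ∞) (s₀ : Time T) :
    Tendsto (fun s => ∫⁻ ω, ‖X ω s₀ - X ω s‖ₑ ^ p ∂P) (𝓝 s₀) (𝓝 0) := by
  have h0 : (0 : ℝ≥0∞) = ∫⁻ _ω : Ω, 0 ∂P := by simp
  rw [h0]
  have h3 : (3 : ℝ≥0∞) ^ p ≠ ∞ := ENNReal.rpow_ne_top_of_nonneg hp.le (by simp)
  refine tendsto_lintegral_filter_of_dominated_convergence
    (fun ω => 3 ^ p * (‖X ω‖ₑ ^ p + ‖X ω‖ₑ ^ p)) ?_ ?_ ?_ ?_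
  · exact Eventually.of_forall fun s =>
      ((measurable_eval hX s₀).sub (measurable_eval hX s)).enorm.pow_const p
  · refine Eventually.of_forall fun s => Eventually.of_forall fun ω => ?_
    refine (ENNReal.rpow_le_rpow enorm_sub_le hp.le).trans ((add_rpow_le hp _ _).trans ?_)
    gcongr <;> exact enorm_apply_le _ _
  · rw [lintegral_const_mul' _ _ h3, lintegral_add_left (hX.enorm.pow_const p)]
    exact (ENNReal.mul_lt_top h3.lt_top (ENNReal.add_lt_top.2 ⟨h, h⟩)).ne
  · refine Eventually.of_forall fun ω => ?_
    have : Continuous fun s => ‖X ω s₀ - X ω s‖ₑ ^ p :=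
      (ENNReal.continuous_rpow_const).comp (by fun_prop)
    simpa [hp] using this.tendsto s₀

/-- The flow is continuous in Wasserstein distance, by path continuity and domination by the
supremum norm; hence the generating sets have open preimages. -/
theorem measurable_lawFlow (hp : 0 < p) (hX : Measurable X) (h : ∫⁻ ω, ‖X ω‖ₑ ^ p ∂P < ∞) :
    Measurable (lawFlow P hp.le hX h) := by
  refine measurable_generateFrom fun U hU => IsOpen.measurableSet ?_
  rw [isOpen_iff_mem_nhds]
  intro s₀ hs₀
  obtain ⟨ε, hε, hU⟩ := hU _ hs₀
  have hε' : 0 < ε ^ p := ENNReal.rpow_pos_of_nonneg hε hp.le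
  filter_upwards [(tendsto_lintegral_enorm_sub hp hX h s₀).eventually_lt_const hε'] with s hs
  refine hU _ ((ENNReal.rpow_lt_rpow_iff hp).1 (lt_of_le_of_lt ?_ hs))
  exact wasserstein_map_rpow_le hp (measurable_eval hX s₀) (measurable_eval hX s)

/-- The drift differs from the integrable function `b · 0 (μ s₀)` by a bounded one: the Lipschitz
condition applies, with `y s` and the distance from `μ s` to `μ s₀` bounded uniformly in `s`. -/
theorem integrable_drift_lawFlow {b : Drift d T p} {K : ℝ≥0} (hT : 0 ≤ T) (hp : 0 < p)
    (hb : b.Admissible) (hK : b.LipschitzBound K) (hX : Measurable X)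
    (h : ∫⁻ ω, ‖X ω‖ₑ ^ p ∂P < ∞) (y : PathSpace d T) :
    Integrable (fun s => b s (y s) (lawFlow P hp.le hX h s)) (timeMeasure T) := by
  set μ := lawFlow P hp.le hX h with hμ
  set s₀ : Time T := ⟨0, le_rfl, hT⟩
  have hm : Measurable fun s => b s (y s) (μ s) :=
    hb.measurable.comp (measurable_id.prodMk
      (y.continuous.measurable.prodMk (measurable_lawFlow hp hX h)))
  have h0 := hb.integrable 0 (μ s₀)
  have hdiff : Integrable (fun s => b s (y s) (μ s) - b s 0 (μ s₀)) (timeMeasure T) := by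
    refine integrable_of_enorm_rpow_le hp
      (hm.aestronglyMeasurable.sub h0.aestronglyMeasurable)
      (c := K * (‖y‖ₑ ^ p + ∫⁻ ω, (3 ^ p * (‖X ω‖ₑ ^ p + ‖X ω‖ₑ ^ p)) ∂P)) ?_ fun s => ?_
    · have h3 : (3 : ℝ≥0∞) ^ p ≠ ∞ := ENNReal.rpow_ne_top_of_nonneg hp.le (by simp)
      rw [lintegral_const_mul' _ _ h3, lintegral_add_left (hX.enorm.pow_const p)]
      have := h.ne
      have hy : ‖y‖ₑ ^ p ≠ ∞ := ENNReal.rpow_ne_top_of_nonneg hp.le (by simp)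
      finiteness
    · refine (hK _ _ _ _ _).trans ?_
      gcongr
      · rw [sub_zero]
        exact enorm_apply_le _ _
      · refine (wasserstein_map_rpow_le hp (measurable_eval hX s) (measurable_eval hX s₀)).trans ?_
        refine lintegral_mono fun ω => ?_
        refine (ENNReal.rpow_le_rpow enorm_sub_le hp.le).trans ((add_rpow_le hp _ _).trans ?_)
        gcongr <;> exact enorm_apply_le _ _
  refine (hdiff.add h0).congr (Eventually.of_forall fun s => ?_)
  simp

end LawFlow

/-! ### Existence by Picard iteration. -/

section Existence

variable {Ω : Type*} {m : MeasurableSpace Ω} {P : Measure Ω} [IsProbabilityMeasure P]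

theorem exists_isDrivenBy_lawFlow {b : Drift d T p} {K : ℝ≥0} (hT : 0 ≤ T) (hp : 1 ≤ p)
    (hb : b.Admissible) (hK : b.LipschitzBound K) {ζ : Ω → Space d} {W Y : Ω → PathSpace d T}
    (hζ : Measurable ζ) (hW : Measurable W) (hY : Measurable Y)
    (hζp : ∫⁻ ω, ‖ζ ω‖ₑ ^ p ∂P < ∞) (hWp : ∫⁻ ω, ‖W ω‖ₑ ^ p ∂P < ∞)
    (hYp : ∫⁻ ω, ‖Y ω‖ₑ ^ p ∂P < ∞) :
    ∃ X : Ω → PathSpace d T, Measurable X ∧ ∫⁻ ω, ‖X ω‖ₑ ^ p ∂P < ∞ ∧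
      ∀ ω, IsDrivenBy b (lawFlow P (zero_le_one.trans hp) hY hYp) (ζ ω) (W ω) (Y ω) (X ω) := by
  have hp0 : 0 < p := by linarith
  have hint := integrable_drift_lawFlow hT hp0 hb hK hY hYp
  set μ := lawFlow P hp0.le hY hYp with hμ
  set X : Ω → PathSpace d T := fun ω =>
    ContinuousMap.const _ (ζ ω) + primitivePath b hint (Y ω) + W ω with hX
  have hXd (ω : Ω) : IsDrivenBy b μ (ζ ω) (W ω) (Y ω) (X ω) :=
    ⟨hint _, fun t => by simp [hX, primitivePath]⟩
  have hXm : Measurable X :=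
    ((ContinuousMap.continuous_const'.measurable.comp hζ).add
      ((continuous_primitivePath hT hp hK hint).measurable.comp hY)).add hW
  refine ⟨X, hXm, ?_, hXd⟩
  have hZm : Measurable fun _ : Ω => (0 : PathSpace d T) := measurable_const
  have hZp : ∫⁻ _ω : Ω, ‖(0 : PathSpace d T)‖ₑ ^ p ∂P < ∞ :=
    lintegral_enorm_rpow_const_lt_top hp0.le _
  have hint' := integrable_drift_lawFlow hT hp0 hb hK hZm hZp
  -- Finiteness of the moment of `X` comes from comparison with the deterministic Picard image of
  -- the zero path under zero inputs.
  set x' : PathSpace d T := primitivePath b hint' 0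
  have hx' (ω : Ω) : IsDrivenBy b (lawFlow P hp0.le hZm hZp) 0 0 0 x' :=
    ⟨hint' _, fun t => by simp [x', primitivePath]⟩
  have key := lintegral_enorm_stopAt_sub_le (P := P) hp hK hζ measurable_const hW measurable_const
    hY measurable_const (fun s => rfl) (fun s => rfl)
    (Eventually.of_forall hXd) (Eventually.of_forall hx') (finalTime hT)
  simp only [sub_zero, stopAt_finalTime] at key
  have hdiff : ∫⁻ ω, ‖X ω - x'‖ₑ ^ p ∂P < ∞ := by
    refine key.trans_lt (ENNReal.add_lt_top.2 ⟨?_, ?_⟩)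
    · exact ENNReal.mul_lt_top (ENNReal.rpow_lt_top_of_nonneg hp0.le (by simp))
        (ENNReal.add_lt_top.2 ⟨hζp, hWp⟩)
    · refine ENNReal.mul_lt_top (by simp) ?_
      calc ∫⁻ s in Set.Iic (finalTime hT), ∫⁻ ω, ‖stopAt s (Y ω)‖ₑ ^ p ∂P ∂(timeMeasure T)
          ≤ ∫⁻ s in Set.Iic (finalTime hT), ∫⁻ ω, ‖Y ω‖ₑ ^ p ∂P ∂(timeMeasure T) := by
            gcongr with s ω
            exact enorm_stopAt_le _ _
        _ < ∞ := by
            rw [lintegral_const]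
            exact ENNReal.mul_lt_top hYp (measure_lt_top _ _)
  have := lintegral_enorm_sub_rpow_lt_top hp0 (hXm.sub_const _) hdiff
    (lintegral_enorm_rpow_const_lt_top hp0.le (-x'))
  simpa using this

/-- Each Picard step halves the exponentially weighted distance, so some iterate contracts the
complete space `L^p(Ω; C_T)`, and its fixed point is fixed by `F` itself. The generality of the
probability space matters: it is later also a finite index set, or `Ω` with a smaller σ-algebra. -/
theorem exists_isMcKeanVlasovSolution {b : Drift d T p} (hT : 0 ≤ T) (hp : 1 ≤ p)
    (hb : b.Admissible) {ζ : Ω → Space d} {W : Ω → PathSpace d T}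
    (hζ : Measurable ζ) (hW : Measurable W)
    (hζp : ∫⁻ ω, ‖ζ ω‖ₑ ^ p ∂P < ∞) (hWp : ∫⁻ ω, ‖W ω‖ₑ ^ p ∂P < ∞) :
    ∃ X, IsMcKeanVlasovSolution P b ζ W X := by
  obtain ⟨K, hK⟩ : ∃ K, b.LipschitzBound K := hb.lipschitz
  have hp0 : 0 < p := by linarith
  have : Fact (1 ≤ ENNReal.ofReal p) := ⟨by simpa using hp⟩
  have hm (f : Lp (PathSpace d T) (ENNReal.ofReal p) P) : Measurable f :=
    (Lp.stronglyMeasurable f).measurable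
  have hfin (f : Lp (PathSpace d T) (ENNReal.ofReal p) P) : ∫⁻ ω, ‖f ω‖ₑ ^ p ∂P < ∞ :=
    (memLp_ofReal_iff hp0 (hm f)).1 (Lp.memLp f)
  choose Γ hΓm hΓp hΓ using fun f : Lp (PathSpace d T) (ENNReal.ofReal p) P =>
    exists_isDrivenBy_lawFlow hT hp hb hK hζ hW (hm f) hζp hWp (hfin f)
  set F : Lp (PathSpace d T) (ENNReal.ofReal p) P → Lp (PathSpace d T) (ENNReal.ofReal p) P :=
    fun f => ((memLp_ofReal_iff hp0 (hΓm f)).2 (hΓp f)).toLp (Γ f) with hF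
  have hFd (f : Lp (PathSpace d T) (ENNReal.ofReal p) P) :
      ∀ᵐ ω ∂P, IsDrivenBy b (lawFlow P hp0.le (hm f) (hfin f)) (ζ ω) (W ω) (f ω) (F f ω) := by
    filter_upwards [((memLp_ofReal_iff hp0 (hΓm f)).2 (hΓp f)).coeFn_toLp] with ω hω
    rw [hω]
    exact hΓ f ω
  set C := growthConst p T K
  have hiter (f g : Lp (PathSpace d T) (ENNReal.ofReal p) P) (n : ℕ) (t : Time T) :
      ∫⁻ ω, ‖stopAt t (F^[n] f ω - F^[n] g ω)‖ₑ ^ p ∂P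
        ≤ (2⁻¹ ^ n * edist f g ^ p) * expWeight C t := by
    induction n generalizing t with
    | zero =>
      rw [pow_zero, one_mul, edist_Lp_rpow hp0]
      refine (le_mul_of_one_le_right' (one_le_expWeight C t)).trans' ?_
      refine lintegral_mono fun ω => ?_
      gcongr
      exact enorm_stopAt_le _ _
    | succ n ih =>
      rw [Function.iterate_succ_apply', Function.iterate_succ_apply']
      refine (lintegral_enorm_stopAt_sub_le hp hK hζ hζ hW hW (hm _) (hm _) (fun s => rfl)
        (fun s => rfl) (hFd _) (hFd _) t).trans ?_
      simp only [sub_self, enorm_stopAt_zero, enorm_zero, ENNReal.zero_rpow_of_pos hp0, lintegral_zero,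
        add_zero, mul_zero, zero_add]
      refine (mul_setLIntegral_le_of_le_expWeight fun s _ => ih s).trans_eq ?_
      ring
  -- The target `2⁻¹ ^ p` becomes the contraction constant `2⁻¹` after taking `p`-th roots.
  obtain ⟨n, hn⟩ : ∃ n : ℕ,
      (2⁻¹ : ℝ≥0∞) ^ n * ENNReal.ofReal (Real.exp (2 * C * T)) ≤ 2⁻¹ ^ p := by
    have h1 : Tendsto (fun n : ℕ => (2⁻¹ : ℝ≥0∞) ^ n * ENNReal.ofReal (Real.exp (2 * C * T)))
        atTop (𝓝 (0 * ENNReal.ofReal (Real.exp (2 * C * T)))) :=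
      ENNReal.Tendsto.mul_const (ENNReal.tendsto_pow_atTop_nhds_zero_of_lt_one (by simp))
        (Or.inr ENNReal.ofReal_ne_top)
    rw [zero_mul] at h1
    have h2 : (0 : ℝ≥0∞) < 2⁻¹ ^ p := ENNReal.rpow_pos_of_nonneg (by simp) hp0.le
    exact (h1.eventually_le_const h2).exists
  have hcontr : ContractingWith 2⁻¹ F^[n] := by
    refine ⟨by norm_num [← NNReal.coe_lt_coe], fun f g => ?_⟩
    refine le_mul_of_rpow_le_mul_rpow hp0 ?_
    have := hiter f g n (finalTime hT)
    simp only [stopAt_finalTime] at this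
    rw [edist_Lp_rpow hp0]
    calc _ ≤ _ := this
      _ = ((2⁻¹ : ℝ≥0∞) ^ n * expWeight C (finalTime hT)) * edist f g ^ p := by ring
      _ ≤ _ := by
        gcongr
        refine hn.trans_eq ?_
        simp
  have hfix := hcontr.isFixedPt_fixedPoint_iterate
  set f := hcontr.fixedPoint F^[n]
  refine ⟨f, hm f, lawFlow P hp0.le (hm f) (hfin f), fun s => rfl, ?_⟩
  have := hFd f
  rw [hfix.eq] at this
  exact this

end Existence

/-! ### Maximal couplings of finitely valued variables. -/

section Coupling

variable {Ω₁ Ω₂ J : Type*} [MeasurableSpace Ω₁] [MeasurableSpace Ω₂]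

theorem sum_restrict_preimage_singleton [Fintype J] [MeasurableSpace J] [MeasurableSingletonClass J]
    (P : Measure Ω₁) {g : Ω₁ → J} (hg : Measurable g) :
    ∑ j, P.restrict (g ⁻¹' {j}) = P := by
  ext s hs
  rw [Measure.finsetSum_apply]
  have h := sum_measure_preimage_singleton (μ := P.restrict s) (f := g) Finset.univ
    fun j _ => hg (measurableSet_singleton j)
  simp only [Finset.coe_univ, Set.preimage_univ, Measure.restrict_apply_univ] at h
  rw [← h]
  refine Finset.sum_congr rfl fun j _ => ?_
  rw [Measure.restrict_apply hs, Measure.restrict_apply (hg (measurableSet_singleton j)),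
    Set.inter_comm]

/-- A measure whose marginals are dominated by two probability measures is dominated by a
coupling of them. -/
theorem exists_coupling_of_le {P₁ : Measure Ω₁} {P₂ : Measure Ω₂} [IsProbabilityMeasure P₁]
    [IsProbabilityMeasure P₂] {π₀ : Measure (Ω₁ × Ω₂)} (h₁ : π₀.map Prod.fst ≤ P₁)
    (h₂ : π₀.map Prod.snd ≤ P₂) :
    ∃ ρ : Measure (Ω₁ × Ω₂), (π₀ + ρ).map Prod.fst = P₁ ∧ (π₀ + ρ).map Prod.snd = P₂ ∧
      ρ Set.univ ≤ 1 - π₀ Set.univ := by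
  have hu₁ : π₀.map Prod.fst Set.univ = π₀ Set.univ := by
    rw [Measure.map_apply measurable_fst MeasurableSet.univ, Set.preimage_univ]
  have hu₂ : π₀.map Prod.snd Set.univ = π₀ Set.univ := by
    rw [Measure.map_apply measurable_snd MeasurableSet.univ, Set.preimage_univ]
  have : IsFiniteMeasure (π₀.map Prod.fst) := isFiniteMeasure_of_le P₁ h₁
  have : IsFiniteMeasure (π₀.map Prod.snd) := isFiniteMeasure_of_le P₂ h₂
  set R₁ := P₁ - π₀.map Prod.fst with hR₁
  set R₂ := P₂ - π₀.map Prod.snd with hR₂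
  set r := 1 - π₀ Set.univ with hr
  have hr₁ : R₁ Set.univ = r := by
    rw [hR₁, Measure.sub_apply MeasurableSet.univ h₁, hu₁, measure_univ]
  have hr₂ : R₂ Set.univ = r := by
    rw [hR₂, Measure.sub_apply MeasurableSet.univ h₂, hu₂, measure_univ]
  have hrtop : r ≠ ∞ := by rw [hr]; finiteness
  have : IsFiniteMeasure R₁ := ⟨by rw [hr₁]; exact hrtop.lt_top⟩
  have : IsFiniteMeasure R₂ := ⟨by rw [hr₂]; exact hrtop.lt_top⟩
  -- The residual measures share the mass `r`, so their normalised product has them as marginals. If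
  -- `r = 0` then `r⁻¹ = ∞`, but both residuals vanish.
  refine ⟨r⁻¹ • R₁.prod R₂, ?_, ?_, ?_⟩
  · rw [Measure.map_add _ _ measurable_fst, Measure.map_smul, Measure.map_fst_prod, hr₂, smul_smul]
    rcases eq_or_ne r 0 with h | h
    · have : R₁ = 0 := by rw [← Measure.measure_univ_eq_zero, hr₁, h]
      rw [this, smul_zero, add_zero]
      rw [← Measure.sub_add_cancel_of_le h₁, ← hR₁, this, zero_add]
    · rw [ENNReal.inv_mul_cancel h hrtop, one_smul, add_comm, hR₁,
        Measure.sub_add_cancel_of_le h₁]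
  · rw [Measure.map_add _ _ measurable_snd, Measure.map_smul, Measure.map_snd_prod, hr₁, smul_smul]
    rcases eq_or_ne r 0 with h | h
    · have : R₂ = 0 := by rw [← Measure.measure_univ_eq_zero, hr₂, h]
      rw [this, smul_zero, add_zero]
      rw [← Measure.sub_add_cancel_of_le h₂, ← hR₂, this, zero_add]
    · rw [ENNReal.inv_mul_cancel h hrtop, one_smul, add_comm, hR₂,
        Measure.sub_add_cancel_of_le h₂]
  · rw [Measure.smul_apply, ← Set.univ_prod_univ, Measure.prod_prod, hr₁, hr₂, smul_eq_mul,
      ← mul_assoc]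
    exact mul_le_of_le_one_left' (ENNReal.inv_mul_le_one r)

/-- A maximal coupling of two random variables with finitely many values. -/
theorem exists_coupling_measure_ne_le [Fintype J] [MeasurableSpace J] [MeasurableSingletonClass J]
    (P₁ : Measure Ω₁) (P₂ : Measure Ω₂) [IsProbabilityMeasure P₁] [IsProbabilityMeasure P₂]
    {g₁ : Ω₁ → J} {g₂ : Ω₂ → J} (hg₁ : Measurable g₁) (hg₂ : Measurable g₂) :
    ∃ π : Measure (Ω₁ × Ω₂), π.map Prod.fst = P₁ ∧ π.map Prod.snd = P₂ ∧
      π {z | g₁ z.1 ≠ g₂ z.2} ≤ ∑ j, (P₁ (g₁ ⁻¹' {j}) - P₂ (g₂ ⁻¹' {j})) := by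
  set a : J → ℝ≥0∞ := fun j => P₁ (g₁ ⁻¹' {j}) with ha
  set c : J → ℝ≥0∞ := fun j => P₂ (g₂ ⁻¹' {j}) with hc
  -- On each value `j`, the shared mass `min (a j) (c j)` is spread over the product of the
  -- conditional laws. There the values agree, so a mismatch costs at most the remaining mass `1 - ∑
  -- min = ∑ (a - c)`, with truncated subtraction.
  set π₀ : Measure (Ω₁ × Ω₂) := ∑ j, (min (a j) (c j) * (a j)⁻¹ * (c j)⁻¹) •
    (P₁.restrict (g₁ ⁻¹' {j})).prod (P₂.restrict (g₂ ⁻¹' {j})) with hπ₀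
  have hmeas₁ (j : J) : MeasurableSet (g₁ ⁻¹' {j}) := hg₁ (measurableSet_singleton j)
  have hmeas₂ (j : J) : MeasurableSet (g₂ ⁻¹' {j}) := hg₂ (measurableSet_singleton j)
  have hatop (j : J) : a j ≠ ∞ := measure_ne_top _ _
  have hctop (j : J) : c j ≠ ∞ := measure_ne_top _ _
  have hcoef (x y : ℝ≥0∞) : min x y * x⁻¹ * y⁻¹ * y ≤ 1 := by
    calc min x y * x⁻¹ * y⁻¹ * y ≤ x * x⁻¹ * (y⁻¹ * y) := by
          rw [mul_assoc (min x y * x⁻¹)]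
          gcongr
          exact min_le_left _ _
      _ ≤ 1 * 1 := by
          gcongr
          · exact ENNReal.mul_inv_le_one x
          · exact ENNReal.inv_mul_le_one y
      _ = 1 := one_mul 1
  have h₁ : π₀.map Prod.fst ≤ P₁ := by
    rw [hπ₀, ← Measure.mapₗ_apply_of_measurable measurable_fst, map_sum]
    conv_rhs => rw [← sum_restrict_preimage_singleton P₁ hg₁]
    refine Finset.sum_le_sum fun j _ => ?_
    rw [Measure.mapₗ_apply_of_measurable measurable_fst, Measure.map_smul, Measure.map_fst_prod,
      Measure.restrict_apply_univ, smul_smul]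
    refine Measure.le_iff.2 fun s hs => ?_
    rw [Measure.smul_apply, smul_eq_mul]
    exact mul_le_of_le_one_left' (hcoef _ _)
  have h₂ : π₀.map Prod.snd ≤ P₂ := by
    rw [hπ₀, ← Measure.mapₗ_apply_of_measurable measurable_snd, map_sum]
    conv_rhs => rw [← sum_restrict_preimage_singleton P₂ hg₂]
    refine Finset.sum_le_sum fun j _ => ?_
    rw [Measure.mapₗ_apply_of_measurable measurable_snd, Measure.map_smul, Measure.map_snd_prod,
      Measure.restrict_apply_univ, smul_smul]
    refine Measure.le_iff.2 fun s hs => ?_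
    rw [Measure.smul_apply, smul_eq_mul]
    refine mul_le_of_le_one_left' (le_trans (le_of_eq ?_) (hcoef (c j) (a j)))
    rw [min_comm]; ring
  obtain ⟨ρ, hρ₁, hρ₂, hρ⟩ := exists_coupling_of_le h₁ h₂
  refine ⟨π₀ + ρ, hρ₁, hρ₂, ?_⟩
  have hzero : π₀ {z | g₁ z.1 ≠ g₂ z.2} = 0 := by
    rw [hπ₀, Measure.finsetSum_apply]
    refine Finset.sum_eq_zero fun j _ => ?_
    rw [Measure.smul_apply, Measure.prod_restrict,
      Measure.restrict_apply' ((hmeas₁ j).prod (hmeas₂ j))]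
    have : {z : Ω₁ × Ω₂ | g₁ z.1 ≠ g₂ z.2} ∩ (g₁ ⁻¹' {j}) ×ˢ (g₂ ⁻¹' {j}) = ∅ := by
      ext z
      simp only [Set.mem_inter_iff, Set.mem_prod, Set.mem_preimage, Set.mem_singleton_iff,
        Set.mem_empty_iff_false, iff_false]
      rintro ⟨hne, h1, h2⟩
      exact hne (h1.trans h2.symm)
    rw [this, measure_empty, smul_zero]
  have hmass : π₀ Set.univ = ∑ j, min (a j) (c j) := by
    rw [hπ₀, Measure.finsetSum_apply]
    refine Finset.sum_congr rfl fun j _ => ?_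
    rw [Measure.smul_apply, ← Set.univ_prod_univ, Measure.prod_prod, Measure.restrict_apply_univ,
      Measure.restrict_apply_univ, smul_eq_mul]
    change min (a j) (c j) * (a j)⁻¹ * (c j)⁻¹ * (a j * c j) = _
    rcases eq_or_ne (a j) 0 with h | h
    · simp [h]
    rcases eq_or_ne (c j) 0 with h' | h'
    · simp [h']
    calc min (a j) (c j) * (a j)⁻¹ * (c j)⁻¹ * (a j * c j)
        = min (a j) (c j) * ((a j)⁻¹ * a j) * ((c j)⁻¹ * c j) := by ring
      _ = _ := by
        rw [ENNReal.inv_mul_cancel h (hatop j), ENNReal.inv_mul_cancel h' (hctop j), mul_one,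
          mul_one]
  have hsum : (1 : ℝ≥0∞) = ∑ j, a j := by
    have := sum_measure_preimage_singleton (μ := P₁) (f := g₁) Finset.univ fun j _ => hmeas₁ j
    simpa using this.symm
  calc (π₀ + ρ) {z | g₁ z.1 ≠ g₂ z.2} ≤ 0 + ρ Set.univ := by
        rw [Measure.add_apply, hzero]
        gcongr
        exact Set.subset_univ _
    _ ≤ 1 - π₀ Set.univ := by rw [zero_add]; exact hρ
    _ ≤ ∑ j, (a j - c j) := by
        rw [hmass, hsum, tsub_le_iff_right, ← Finset.sum_add_distrib]
        refine Finset.sum_le_sum fun j _ => ?_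
        rw [← tsub_le_iff_right, tsub_min]

end Coupling

/-! ### Empirical measures as laws on the index set, and the law of large numbers. -/

section Empirical

variable {ι : Type*} [Fintype ι] [Nonempty ι] {E : Type*} [MeasurableSpace E]

theorem lintegral_empirical [MeasurableSpace ι] [MeasurableSingletonClass ι] (h : ι → ℝ≥0∞) :
    ∫⁻ i, h i ∂(empirical (id : ι → ι) : Measure ι) = (Fintype.card ι : ℝ≥0∞)⁻¹ * ∑ i, h i := by
  simp [empirical, lintegral_smul_measure, lintegral_finsetSum_measure]

/-- Here `empirical id` is the uniform distribution on the indices; this identity turns the particle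
system into a McKean–Vlasov equation. -/
theorem map_empirical [MeasurableSpace ι] {x : ι → E} (hx : Measurable x) :
    (empirical (id : ι → ι) : Measure ι).map x = empirical x := by
  simp only [empirical, ProbabilityMeasure.coe_mk, id]
  rw [Measure.map_smul, ← Measure.mapₗ_apply_of_measurable hx, map_sum]
  simp [Measure.mapₗ_apply_of_measurable hx, Measure.map_dirac' hx]

end Empirical

section LawOfLargeNumbers

variable {Ω : Type*} {m : MeasurableSpace Ω} {P : Measure Ω}
  {S : Type*} [MeasurableSpace S] {Z : ℕ → Ω → S} {Z' : Ω → S}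

/-- The strong law of large numbers for empirical measures. -/
theorem ae_tendsto_lintegral_empirical (hindep : iIndepFun Z P)
    (hident : ∀ i, IdentDistrib (Z i) Z' P P) {h : S → ℝ≥0∞} (hh : Measurable h)
    (hh' : ∀ x, h x ≠ ∞) (hfin : ∫⁻ ω, h (Z' ω) ∂P ≠ ∞) :
    ∀ᵐ ω ∂P, Tendsto (fun N => ∫⁻ i, h (Z i ω) ∂(empirical (id : Fin (N + 1) → Fin (N + 1)) :
      Measure (Fin (N + 1)))) atTop (𝓝 (∫⁻ ω, h (Z' ω) ∂P)) := by
  have hm : Measurable fun x => (h x).toReal := hh.ennreal_toReal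
  have hint : Integrable (fun ω => (h (Z' ω)).toReal) P :=
    integrable_toReal_of_lintegral_ne_top (hh.comp_aemeasurable (hident 0).aemeasurable_snd) hfin
  have hid (i : ℕ) : IdentDistrib (fun ω => (h (Z i ω)).toReal) (fun ω => (h (Z' ω)).toReal) P P :=
    (hident i).comp hm
  have key := strong_law_ae_real (fun i ω => (h (Z i ω)).toReal) ((hid 0).integrable_iff.2 hint)
    (fun i j hij => (hindep.indepFun hij).comp hm hm) fun i => (hid i).trans (hid 0).symm
  have hlim : ∫ ω, (h (Z 0 ω)).toReal ∂P = (∫⁻ ω, h (Z' ω) ∂P).toReal := by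
    rw [(hid 0).integral_eq, integral_toReal (f := fun ω => h (Z' ω))
      (hh.comp_aemeasurable (hident 0).aemeasurable_snd)
      (Eventually.of_forall fun ω => (hh' _).lt_top)]
  filter_upwards [key] with ω hω
  rw [hlim] at hω
  have h2 := (ENNReal.tendsto_ofReal (hω.comp (tendsto_add_atTop_nat 1)))
  rw [ENNReal.ofReal_toReal hfin] at h2
  refine h2.congr fun N => ?_
  rw [lintegral_empirical (fun i : Fin (N + 1) => h (Z i ω)), Function.comp_apply,
    Finset.sum_range, Fintype.card_fin, ENNReal.ofReal_div_of_pos (by positivity),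
    ENNReal.ofReal_sum_of_nonneg (fun _ _ => ENNReal.toReal_nonneg), ENNReal.div_eq_inv_mul,
    ENNReal.ofReal_natCast]
  simp_rw [ENNReal.ofReal_toReal (hh' _)]

end LawOfLargeNumbers

/-! ### Almost sure convergence of the empirical inputs, in terms of couplings. -/

section CouplingLLN

variable {Ω : Type*} {m : MeasurableSpace Ω} {P : Measure Ω} [IsProbabilityMeasure P]
  {S : Type*} [NormedAddCommGroup S] [MeasurableSpace S] [BorelSpace S] [SecondCountableTopology S]
  {Z : ℕ → Ω → S} {Z' : Ω → S} {p : ℝ}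

/-- Approximating the identity in `L^p` of the law of `Z'` reduces the coupling problem to finitely
many values. -/
theorem exists_simpleFunc_lintegral_sub_le (hp : 1 ≤ p) (hZ' : Measurable Z')
    (hfin : ∫⁻ ω, ‖Z' ω‖ₑ ^ p ∂P < ∞) {δ : ℝ≥0∞} (hδ : δ ≠ 0) :
    ∃ f : SimpleFunc S S, ∫⁻ ω, ‖Z' ω - f (Z' ω)‖ₑ ^ p ∂P ≤ δ := by
  have hp0 : 0 < p := by linarith
  have : IsProbabilityMeasure (P.map Z') := Measure.isProbabilityMeasure_map hZ'.aemeasurable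
  have hmem : MemLp (id : S → S) (ENNReal.ofReal p) (P.map Z') := by
    rw [memLp_ofReal_iff hp0 measurable_id, lintegral_map (by fun_prop) hZ']
    exact hfin
  have hδ' : δ ^ p⁻¹ ≠ 0 := by simp [hδ, hp0.le]
  obtain ⟨f, hf, -⟩ := hmem.exists_simpleFunc_eLpNorm_sub_lt (by simp) hδ'
  refine ⟨f, ?_⟩
  rw [eLpNorm_eq_lintegral_rpow_enorm_toReal (by simpa using hp0) (by simp),
    ENNReal.toReal_ofReal hp0.le, one_div, ENNReal.rpow_lt_rpow_iff (by positivity)] at hf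
  rw [lintegral_map (by have := f.measurable; fun_prop) hZ'] at hf
  exact hf.le

theorem lintegral_comp_fst_of_map_eq {Ω₁ Ω₂ : Type*} [MeasurableSpace Ω₁] [MeasurableSpace Ω₂]
    {π : Measure (Ω₁ × Ω₂)} {P₁ : Measure Ω₁} (hπ : π.map Prod.fst = P₁) {f : Ω₁ → ℝ≥0∞}
    (hf : Measurable f) : ∫⁻ z, f z.1 ∂π = ∫⁻ x, f x ∂P₁ := by
  rw [← hπ, lintegral_map hf measurable_fst]

theorem lintegral_comp_snd_of_map_eq {Ω₁ Ω₂ : Type*} [MeasurableSpace Ω₁] [MeasurableSpace Ω₂]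
    {π : Measure (Ω₁ × Ω₂)} {P₂ : Measure Ω₂} (hπ : π.map Prod.snd = P₂) {f : Ω₂ → ℝ≥0∞}
    (hf : Measurable f) : ∫⁻ z, f z.2 ∂π = ∫⁻ x, f x ∂P₂ := by
  rw [← hπ, lintegral_map hf measurable_snd]

/-- Almost surely, the empirical measures of an i.i.d. sequence with finite `p`-th moment converge
to the common law in `p`-Wasserstein distance; the couplings are realized on the index set and the
probability space. -/
theorem ae_eventually_exists_coupling (hp : 1 ≤ p) (hindep : iIndepFun Z P)
    (hident : ∀ i, IdentDistrib (Z i) Z' P P) (hZ' : Measurable Z')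
    (hfin : ∫⁻ ω, ‖Z' ω‖ₑ ^ p ∂P < ∞) :
    ∀ᵐ ω ∂P, ∀ ε : ℝ≥0∞, 0 < ε → ∀ᶠ N in atTop, ∃ π : Measure (Fin (N + 1) × Ω),
      π.map Prod.fst = (empirical (id : Fin (N + 1) → Fin (N + 1)) : Measure (Fin (N + 1))) ∧
      π.map Prod.snd = P ∧ ∫⁻ z, ‖Z z.1 ω - Z' z.2‖ₑ ^ p ∂π ≤ ε := by
  have hp0 : 0 < p := by linarith
  have h3 : (3 : ℝ≥0∞) ^ p ≠ ∞ := ENNReal.rpow_ne_top_of_nonneg hp0.le (by simp)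
  have h3' : (3 : ℝ≥0∞) ^ p ≠ 0 := by simp
  -- The discretised values are coupled maximally; frequencies converge to probabilities, so the
  -- mismatch probability tends to zero, and on a mismatch the values are at most `2 R` apart. Of
  -- the four `δ`, two bound the empirical discretisation error (eventually below twice its limit
  -- bound), one the mismatch, one the discretisation of `Z'`.
  have main : ∀ δ : ℝ≥0∞, δ ≠ 0 → ∀ᵐ ω ∂P, ∀ᶠ N in atTop, ∃ π : Measure (Fin (N + 1) × Ω),
      π.map Prod.fst = (empirical (id : Fin (N + 1) → Fin (N + 1)) : Measure (Fin (N + 1))) ∧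
      π.map Prod.snd = P ∧ ∫⁻ z, ‖Z z.1 ω - Z' z.2‖ₑ ^ p ∂π ≤ 3 ^ p * (δ + δ + δ + δ) := by
    intro δ hδ
    obtain ⟨f, hf⟩ := exists_simpleFunc_lintegral_sub_le hp hZ' hfin hδ
    rcases eq_or_ne δ ∞ with rfl | hδtop
    · refine Eventually.of_forall fun ω => Eventually.of_forall fun N =>
        ⟨(empirical (id : Fin (N + 1) → Fin (N + 1)) : Measure (Fin (N + 1))).prod P, ?_, ?_, ?_⟩
      · rw [Measure.map_fst_prod, measure_univ, one_smul]
      · rw [Measure.map_snd_prod, measure_univ, one_smul]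
      · simp [ENNReal.mul_top h3']
    obtain ⟨R, hR⟩ := f.exists_forall_norm_le
    set g : S → f.range := fun x => ⟨f x, f.mem_range_self x⟩ with hg
    have hgm : Measurable g := f.measurable.subtype_mk
    have hfm : Measurable fun x => ‖x - f x‖ₑ ^ p := by have := f.measurable; fun_prop
    have hlln := ae_tendsto_lintegral_empirical hindep hident hfm
      (fun x => ENNReal.rpow_ne_top_of_nonneg hp0.le (by simp)) (ne_top_of_le_ne_top hδtop hf)
    have hlln' : ∀ᵐ ω ∂P, ∀ j : f.range, Tendsto (fun N =>
        (empirical (id : Fin (N + 1) → Fin (N + 1)) : Measure (Fin (N + 1)))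
          ((fun i : Fin (N + 1) => g (Z i ω)) ⁻¹' {j})) atTop
        (𝓝 (P ((fun ω => g (Z' ω)) ⁻¹' {j}))) := by
      refine ae_all_iff.2 fun j => ?_
      have hj : MeasurableSet (g ⁻¹' {j}) := hgm (measurableSet_singleton j)
      have := ae_tendsto_lintegral_empirical hindep hident
        (h := (g ⁻¹' {j}).indicator (1 : S → ℝ≥0∞)) (measurable_one.indicator hj)
        (fun x => by by_cases hx : x ∈ g ⁻¹' {j} <;> simp [hx])
        (ne_top_of_le_ne_top (b := 1) (by simp) ((lintegral_mono fun ω =>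
          Set.indicator_le_self' (fun _ _ => zero_le_one) _).trans (by simp)))
      filter_upwards [this] with ω hω
      have e1 : ∫⁻ ω, (g ⁻¹' {j}).indicator (1 : S → ℝ≥0∞) (Z' ω) ∂P
          = P ((fun ω => g (Z' ω)) ⁻¹' {j}) := by
        have hj' : MeasurableSet ((fun ω => g (Z' ω)) ⁻¹' {j}) :=
          (hgm.comp hZ') (measurableSet_singleton j)
        rw [← lintegral_indicator_one hj']
        rfl
      rw [e1] at hω
      refine hω.congr fun N => ?_
      rw [← lintegral_indicator_one (MeasurableSet.of_discrete)]
      rfl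
    filter_upwards [hlln, hlln'] with ω h1 h2
    have hsum : Tendsto (fun N => (2 * ENNReal.ofReal R) ^ p * ∑ j : f.range,
        ((empirical (id : Fin (N + 1) → Fin (N + 1)) : Measure (Fin (N + 1)))
          ((fun i : Fin (N + 1) => g (Z i ω)) ⁻¹' {j}) - P ((fun ω => g (Z' ω)) ⁻¹' {j})))
        atTop (𝓝 ((2 * ENNReal.ofReal R) ^ p * ∑ j : f.range,
          (P ((fun ω => g (Z' ω)) ⁻¹' {j}) - P ((fun ω => g (Z' ω)) ⁻¹' {j})))) := by
      refine ENNReal.Tendsto.const_mul (tendsto_finsetSum _ fun j _ =>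
        ENNReal.Tendsto.sub (h2 j) tendsto_const_nhds (Or.inl (measure_ne_top _ _))) (Or.inr ?_)
      exact ENNReal.rpow_ne_top_of_nonneg hp0.le (by finiteness)
    simp only [tsub_self, Finset.sum_const_zero, mul_zero] at hsum
    have hδ2 : ∫⁻ ω, ‖Z' ω - f (Z' ω)‖ₑ ^ p ∂P < δ + δ :=
      hf.trans_lt (ENNReal.lt_add_right hδtop hδ)
    filter_upwards [h1.eventually_le_const hδ2, hsum.eventually_le_const hδ.bot_lt] with N h1 h2
    obtain ⟨π, hπ1, hπ2, hπ⟩ := exists_coupling_measure_ne_le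
      (empirical (id : Fin (N + 1) → Fin (N + 1)) : Measure (Fin (N + 1))) P
      (g₁ := fun i => g (Z i ω)) (g₂ := fun ω => g (Z' ω)) Measurable.of_discrete (hgm.comp hZ')
    refine ⟨π, hπ1, hπ2, ?_⟩
    have hne : MeasurableSet {z : Fin (N + 1) × Ω | g (Z z.1 ω) ≠ g (Z' z.2)} := by
      have hd : Measurable fun z : Fin (N + 1) × Ω => (g (Z z.1 ω), g (Z' z.2)) :=
        ((Measurable.of_discrete (f := fun i : Fin (N + 1) => g (Z i ω))).comp
          measurable_fst).prodMk ((hgm.comp hZ').comp measurable_snd)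
      exact hd (MeasurableSet.of_discrete (s := {q : f.range × f.range | q.1 ≠ q.2}))
    have hm1 : Measurable fun z : Fin (N + 1) × Ω => ‖Z z.1 ω - f (Z z.1 ω)‖ₑ ^ p :=
      (Measurable.of_discrete (f := fun i : Fin (N + 1) => ‖Z i ω - f (Z i ω)‖ₑ ^ p)).comp
        measurable_fst
    have hm2 : Measurable fun z : Fin (N + 1) × Ω =>
        {z : Fin (N + 1) × Ω | g (Z z.1 ω) ≠ g (Z' z.2)}.indicator
          (fun _ => (2 * ENNReal.ofReal R) ^ p) z := measurable_const.indicator hne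
    have hm12 : Measurable fun z : Fin (N + 1) × Ω => ‖Z z.1 ω - f (Z z.1 ω)‖ₑ ^ p +
        {z : Fin (N + 1) × Ω | g (Z z.1 ω) ≠ g (Z' z.2)}.indicator
          (fun _ => (2 * ENNReal.ofReal R) ^ p) z := hm1.add hm2
    calc ∫⁻ z, ‖Z z.1 ω - Z' z.2‖ₑ ^ p ∂π
        ≤ ∫⁻ z, 3 ^ p * (‖Z z.1 ω - f (Z z.1 ω)‖ₑ ^ p +
          {z : Fin (N + 1) × Ω | g (Z z.1 ω) ≠ g (Z' z.2)}.indicator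
          (fun _ => (2 * ENNReal.ofReal R) ^ p) z + ‖Z' z.2 - f (Z' z.2)‖ₑ ^ p) ∂π := by
          refine lintegral_mono fun z => ?_
          have e : Z z.1 ω - Z' z.2 = (Z z.1 ω - f (Z z.1 ω)) + (f (Z z.1 ω) - f (Z' z.2))
            + -(Z' z.2 - f (Z' z.2)) := by abel
          have hle : ‖Z z.1 ω - Z' z.2‖ₑ ≤ ‖Z z.1 ω - f (Z z.1 ω)‖ₑ + ‖f (Z z.1 ω) - f (Z' z.2)‖ₑ
              + ‖Z' z.2 - f (Z' z.2)‖ₑ := by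
            conv_lhs => rw [e]
            refine (enorm_add_le _ _).trans ?_
            rw [enorm_neg]
            gcongr
            exact enorm_add_le _ _
          refine (ENNReal.rpow_le_rpow hle hp0.le).trans ((add_add_rpow_le hp0.le _ _ _).trans ?_)
          gcongr
          by_cases hz : g (Z z.1 ω) = g (Z' z.2)
          · have : f (Z z.1 ω) = f (Z' z.2) := congrArg Subtype.val hz
            simp [this, hp0]
          · rw [Set.indicator_of_mem (by exact hz)]
            gcongr
            refine enorm_sub_le.trans ?_
            rw [two_mul]
            gcongr
            · rw [← ofReal_norm]; exact ENNReal.ofReal_le_ofReal (hR _)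
            · rw [← ofReal_norm]; exact ENNReal.ofReal_le_ofReal (hR _)
      _ = 3 ^ p * (∫⁻ i, ‖Z i ω - f (Z i ω)‖ₑ ^ p
            ∂(empirical (id : Fin (N + 1) → Fin (N + 1)) : Measure (Fin (N + 1)))
          + (2 * ENNReal.ofReal R) ^ p * π {z | g (Z z.1 ω) ≠ g (Z' z.2)}
          + ∫⁻ ω, ‖Z' ω - f (Z' ω)‖ₑ ^ p ∂P) := by
          rw [lintegral_const_mul' _ _ h3, lintegral_add_left hm12, lintegral_add_left hm1,
            lintegral_indicator_const hne,
            lintegral_comp_fst_of_map_eq hπ1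
              (f := fun i : Fin (N + 1) => ‖Z i ω - f (Z i ω)‖ₑ ^ p) Measurable.of_discrete,
            lintegral_comp_snd_of_map_eq hπ2 (f := fun ω => ‖Z' ω - f (Z' ω)‖ₑ ^ p)
              (hfm.comp hZ')]
      _ ≤ 3 ^ p * (δ + δ + δ + δ) := by
          gcongr 3 ^ p * (?_ + ?_ + ?_)
          exact (mul_le_mul_right hπ _).trans h2
  -- Countably many tolerances give one null set for all `ε`. At `n = 0` the tolerance is `∞`, the
  -- trivial case of `main`.
  have hseq : ∀ᵐ ω ∂P, ∀ n : ℕ, ∀ᶠ N in atTop, ∃ π : Measure (Fin (N + 1) × Ω),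
      π.map Prod.fst = (empirical (id : Fin (N + 1) → Fin (N + 1)) : Measure (Fin (N + 1))) ∧
      π.map Prod.snd = P ∧ ∫⁻ z, ‖Z z.1 ω - Z' z.2‖ₑ ^ p ∂π ≤
        3 ^ p * ((n : ℝ≥0∞)⁻¹ + (n : ℝ≥0∞)⁻¹ + (n : ℝ≥0∞)⁻¹ + (n : ℝ≥0∞)⁻¹) :=
    ae_all_iff.2 fun n => main _ (by simp)
  filter_upwards [hseq] with ω hω ε hε
  have hlim : Tendsto (fun n : ℕ => 3 ^ p *
      ((n : ℝ≥0∞)⁻¹ + (n : ℝ≥0∞)⁻¹ + (n : ℝ≥0∞)⁻¹ + (n : ℝ≥0∞)⁻¹)) atTop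
      (𝓝 (3 ^ p * (0 + 0 + 0 + 0))) := by
    have h := ENNReal.tendsto_inv_nat_nhds_zero
    exact ENNReal.Tendsto.const_mul (((h.add h).add h).add h) (Or.inr h3)
  simp only [add_zero, mul_zero] at hlim
  obtain ⟨n, hn⟩ := (hlim.eventually_le_const hε).exists
  filter_upwards [hω n] with N ⟨π, h1, h2, h3⟩
  exact ⟨π, h1, h2, h3.trans hn⟩

end CouplingLLN

variable {d : ℕ} {T p : ℝ}

/-! ### Measurability of random paths. -/

section Measurability

/-- The distance to a fixed path is a supremum over countably many times, and by separability open
sets are countable unions of balls. -/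
theorem measurable_pathSpace_of_eval [Nonempty (Time T)] {Ω : Type*} {m : MeasurableSpace Ω}
    {X : Ω → PathSpace d T} (h : ∀ s, Measurable fun ω => X ω s) : Measurable X := by
  have hdist (y : PathSpace d T) : Measurable fun ω => edist (X ω) y := by
    have e : (fun ω => edist (X ω) y) = fun ω =>
        ⨆ n, ‖X ω (TopologicalSpace.denseSeq (Time T) n)
          - y (TopologicalSpace.denseSeq (Time T) n)‖ₑ := by
      funext ω
      rw [edist_eq_enorm_sub]
      refine le_antisymm (enorm_path_le_iff.2 ?_) (iSup_le fun n => enorm_apply_le (X ω - y) _)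
      have hcl : IsClosed {s | ‖(X ω - y) s‖ₑ ≤ ⨆ n,
          ‖X ω (TopologicalSpace.denseSeq (Time T) n)
            - y (TopologicalSpace.denseSeq (Time T) n)‖ₑ} :=
        isClosed_le (by fun_prop) continuous_const
      refine isClosed_property (TopologicalSpace.denseRange_denseSeq (Time T)) hcl fun n => ?_
      exact le_iSup (fun n => ‖X ω (TopologicalSpace.denseSeq (Time T) n)
            - y (TopologicalSpace.denseSeq (Time T) n)‖ₑ) n
    rw [e]
    exact Measurable.iSup fun n => ((h _).sub_const _).enorm
  refine measurable_of_isOpen fun U hU => ?_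
  choose! r hr hrU using fun y (hy : y ∈ U) => EMetric.isOpen_iff.1 hU y hy
  obtain ⟨t, ht, htU⟩ := TopologicalSpace.isOpen_biUnion_countable U (fun y => Metric.eball y (r y))
    fun y _ => Metric.isOpen_eball
  have hUeq : U = ⋃ y ∈ t, Metric.eball y (r y) := by
    rw [htU.2]
    refine Set.Subset.antisymm (fun y hy => ?_) (Set.iUnion₂_subset fun y hy => hrU y hy)
    exact Set.mem_iUnion₂.2 ⟨y, hy, Metric.mem_eball_self (hr y hy)⟩
  rw [hUeq, Set.preimage_iUnion₂]
  exact MeasurableSet.biUnion htU.1 fun y _ => measurableSet_lt (hdist y) measurable_const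

theorem AdaptedInput.measurable_init {Ω : Type*} {m : MeasurableSpace Ω}
    {𝒢 : Filtration (Time T) m} {ζ : Ω → Space d} {W : Ω → PathSpace d T}
    (h : AdaptedInput 𝒢 ζ W) (t : Time T) : Measurable[𝒢 t] ζ := by
  have h0 : (0 : ℝ) ∈ Set.Icc 0 T := ⟨le_rfl, t.2.1.trans t.2.2⟩
  exact (h.1 ⟨0, h0⟩ rfl).mono (𝒢.mono t.2.1) le_rfl

theorem AdaptedInput.measurable_stopAt {Ω : Type*} {m : MeasurableSpace Ω}
    {𝒢 : Filtration (Time T) m} {ζ : Ω → Space d} {W : Ω → PathSpace d T}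
    (h : AdaptedInput 𝒢 ζ W) (t : Time T) : Measurable[𝒢 t] fun ω => stopAt t (W ω) := by
  have : Nonempty (Time T) := ⟨t⟩
  refine measurable_pathSpace_of_eval (m := 𝒢 t) fun s => ?_
  exact (h.2 (min s t)).mono (𝒢.mono (min_le_right s t)) le_rfl

theorem measurable_of_ae_eq_of_null {Ω E : Type*} {m 𝒢 : MeasurableSpace Ω} [MeasurableSpace E]
    {P : Measure[m] Ω} (hnull : ∀ s : Set Ω, P s = 0 → MeasurableSet[𝒢] s) {f g : Ω → E}
    (hg : Measurable[𝒢] g) (hfg : f =ᵐ[P] g) : Measurable[𝒢] f := by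
  intro A hA
  have hN : P {ω | f ω ≠ g ω} = 0 := ae_iff.1 hfg
  have e : f ⁻¹' A = (g ⁻¹' A \ {ω | f ω ≠ g ω}) ∪ (f ⁻¹' A ∩ {ω | f ω ≠ g ω}) := by
    ext ω
    by_cases h : f ω = g ω <;> simp [h]
  rw [e]
  exact ((hg hA).diff (hnull _ hN)).union (hnull _ (measure_mono_null Set.inter_subset_right hN))

theorem lintegral_enorm_rpow_trim {Ω E : Type*} {m 𝒢 : MeasurableSpace Ω} {P : Measure[m] Ω}
    (hle : 𝒢 ≤ m) [NormedAddCommGroup E] [MeasurableSpace E] [OpensMeasurableSpace E] {f : Ω → E}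
    (hf : Measurable[𝒢] f) : ∫⁻ ω, ‖f ω‖ₑ ^ p ∂(P.trim hle) = ∫⁻ ω, ‖f ω‖ₑ ^ p ∂P :=
  lintegral_trim hle ((by fun_prop : Measurable fun x : E => ‖x‖ₑ ^ p).comp hf)

theorem measurable_eval_pi {Ω ι : Type*} {m : MeasurableSpace Ω} {X : Ω → ι → PathSpace d T}
    (hX : Measurable X) (t : Time T) : Measurable fun ω i => X ω i t :=
  measurable_pi_lambda _ fun i => measurable_eval ((measurable_pi_apply i).comp hX) t

end Measurability

/-! ### Change of probability space, causality and adaptedness. -/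

section Transfer

variable {Ω Ω' : Type*} {m : MeasurableSpace Ω} {m' : MeasurableSpace Ω'} {P : Measure Ω}
  {P' : Measure Ω'} {b : Drift d T p}

/-- Measure-preserving maps do not change laws. This brings solutions living on different spaces
onto one space, where stability applies. -/
theorem IsMcKeanVlasovSolution.comp {ζ : Ω → Space d} {W X : Ω → PathSpace d T}
    (hX : IsMcKeanVlasovSolution P b ζ W X) {φ : Ω' → Ω} (hφ : MeasurePreserving φ P' P) :
    IsMcKeanVlasovSolution P' b (ζ ∘ φ) (W ∘ φ) (X ∘ φ) := by
  obtain ⟨μ, hμ, h⟩ := hX.solves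
  refine ⟨hX.measurable.comp hφ.measurable, μ, fun s => ?_, hφ.quasiMeasurePreserving.ae h⟩
  rw [hμ, ← hφ.map_eq, Measure.map_map (measurable_eval hX.measurable s) hφ.measurable]
  rfl

theorem IsMcKeanVlasovSolution.ae_stopAt_eq [IsProbabilityMeasure P] (hp : 1 ≤ p)
    (hb : b.Admissible) {ζ : Ω → Space d} {W W' X X' : Ω → PathSpace d T}
    (hX : IsMcKeanVlasovSolution P b ζ W X) (hX' : IsMcKeanVlasovSolution P b ζ W' X')
    (hζ : Measurable ζ) (hW : Measurable W) (hW' : Measurable W')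
    (hζp : ∫⁻ ω, ‖ζ ω‖ₑ ^ p ∂P < ∞)
    (hWp : ∫⁻ ω, ‖W ω‖ₑ ^ p ∂P < ∞) (hWp' : ∫⁻ ω, ‖W' ω‖ₑ ^ p ∂P < ∞) {t : Time T}
    (hWW' : ∀ ω, stopAt t (W ω) = stopAt t (W' ω)) :
    ∀ᵐ ω ∂P, stopAt t (X ω) = stopAt t (X' ω) := by
  obtain ⟨K, hK⟩ : ∃ K, b.LipschitzBound K := hb.lipschitz
  have hp0 : 0 < p := by linarith
  have h := hX.stability hp hK hX' hζ hζ hW hW' hζp hζp hWp hWp' t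
  have hz : ∀ ω, ‖stopAt t (W ω - W' ω)‖ₑ ^ p = 0 := fun ω => by
    rw [stopAt_sub, hWW', ← stopAt_sub, sub_self, enorm_stopAt_zero, ENNReal.zero_rpow_of_pos hp0]
  simp only [hz, sub_self, enorm_zero, ENNReal.zero_rpow_of_pos hp0, lintegral_zero, add_zero,
    mul_zero, nonpos_iff_eq_zero] at h
  have hm : Measurable fun ω => ‖stopAt t (X ω - X' ω)‖ₑ ^ p :=
    ((continuous_stopAt t).measurable.comp (hX.measurable.sub hX'.measurable)).enorm.pow_const p
  rw [lintegral_eq_zero_iff hm] at h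
  filter_upwards [h] with ω hω
  simp only [Pi.zero_apply, ENNReal.rpow_eq_zero_iff_of_pos hp0] at hω
  ext1 s
  have := enorm_apply_le (stopAt t (X ω - X' ω)) s
  rw [hω, nonpos_iff_eq_zero, enorm_eq_zero] at this
  exact sub_eq_zero.1 this

theorem IsMcKeanVlasovSolution.ae_eq [IsProbabilityMeasure P] (hT : 0 ≤ T) (hp : 1 ≤ p)
    (hb : b.Admissible) {ζ : Ω → Space d} {W X X' : Ω → PathSpace d T}
    (hX : IsMcKeanVlasovSolution P b ζ W X) (hX' : IsMcKeanVlasovSolution P b ζ W X')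
    (hζ : Measurable ζ) (hW : Measurable W)
    (hζp : ∫⁻ ω, ‖ζ ω‖ₑ ^ p ∂P < ∞) (hWp : ∫⁻ ω, ‖W ω‖ₑ ^ p ∂P < ∞) : X =ᵐ[P] X' := by
  filter_upwards [hX.ae_stopAt_eq hp hb hX' hζ hW hW hζp hWp hWp (t := finalTime hT) fun _ => rfl]
    with ω hω
  rwa [stopAt_finalTime, stopAt_finalTime] at hω

/-- Solutions of the McKean-Vlasov equation are adapted to every filtration which contains the
null sets and to which the inputs are adapted. -/
theorem IsMcKeanVlasovSolution.isStronglyProgressive [IsProbabilityMeasure P] (hp : 1 ≤ p)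
    (hb : b.Admissible) {ζ : Ω → Space d} {W X : Ω → PathSpace d T}
    (hX : IsMcKeanVlasovSolution P b ζ W X) (hζ : Measurable ζ) (hW : Measurable W)
    (hζp : ∫⁻ ω, ‖ζ ω‖ₑ ^ p ∂P < ∞) (hWp : ∫⁻ ω, ‖W ω‖ₑ ^ p ∂P < ∞)
    {𝒢 : Filtration (Time T) m} (h𝒢 : ∀ s : Set Ω, P s = 0 → ∀ t, MeasurableSet[𝒢 t] s)
    (hin : AdaptedInput 𝒢 ζ W) : IsStronglyProgressive 𝒢 fun t ω => X ω t := by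
  have hp0 : 0 < p := by linarith
  refine StronglyAdapted.isStronglyProgressive_of_continuous (fun t => ?_) fun ω => (X ω).continuous
  refine Measurable.stronglyMeasurable (?_ : Measurable[𝒢 t] fun ω => X ω t)
  have hT : 0 ≤ T := t.2.1.trans t.2.2
  have hle := 𝒢.le t
  have hζt := hin.measurable_init t
  have hWt := hin.measurable_stopAt t
  have hWtm : Measurable fun ω => stopAt t (W ω) := (continuous_stopAt t).measurable.comp hW
  have hWtp : ∫⁻ ω, ‖stopAt t (W ω)‖ₑ ^ p ∂P < ∞ := by
    refine lt_of_le_of_lt (lintegral_mono fun ω => ?_) hWp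
    exact ENNReal.rpow_le_rpow (enorm_stopAt_le _ _) hp0.le
  have hid : @MeasurePreserving Ω Ω m (𝒢 t) id P (P.trim hle) :=
    @MeasurePreserving.mk Ω Ω m (𝒢 t) id P (P.trim hle) (measurable_id'' hle)
      (trim_eq_map hle).symm
  have hprob : @IsProbabilityMeasure Ω (𝒢 t) (P.trim hle) :=
    ⟨by rw [trim_measurableSet_eq hle MeasurableSet.univ, measure_univ]⟩
  -- The equation with noise stopped at `t` is solved on `Ω` with the σ-algebra `𝒢 t`, so `Y` is `𝒢
  -- t`-measurable by construction. By causality it agrees with `X` up to time `t` almost surely,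
  -- and `𝒢 t` contains the null sets.
  obtain ⟨Y, hY⟩ := exists_isMcKeanVlasovSolution (m := 𝒢 t) (P := P.trim hle) hT hp hb hζt hWt
    (by rwa [lintegral_enorm_rpow_trim hle hζt])
    (by rwa [lintegral_enorm_rpow_trim hle hWt])
  have hY' := hY.comp hid
  have hae := hX.ae_stopAt_eq hp hb hY' hζ hW hWtm hζp hWp hWtp (t := t)
    fun ω => (stopAt_stopAt t (W ω)).symm
  refine measurable_of_ae_eq_of_null (P := P) (fun s hs => h𝒢 s hs t)
    (measurable_eval hY.measurable t) ?_
  filter_upwards [hae] with ω hω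
  have := DFunLike.congr_fun hω t
  simpa using this

end Transfer

/-! ### The particle system as a McKean–Vlasov equation. -/

section ParticleSystem

variable {ι : Type*} [Fintype ι] [Nonempty ι] [MeasurableSpace ι] [DiscreteMeasurableSpace ι]
  {b : Drift d T p}

/-- Every index has positive mass, so almost sure statements on the index set hold for each
particle. -/
theorem ae_empirical_iff {q : ι → Prop} :
    (∀ᵐ i ∂(empirical (id : ι → ι) : Measure ι), q i) ↔ ∀ i, q i := by
  rw [ae_iff_of_countable]
  refine forall_congr' fun i => ⟨fun h => h ?_, fun h _ => h⟩
  classical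
  rw [← lintegral_indicator_one (measurableSet_singleton i), lintegral_empirical]
  refine mul_ne_zero (by simp) fun h => ?_
  have := Finset.sum_eq_zero_iff.1 h i (Finset.mem_univ i)
  simp at this

theorem lintegral_empirical_lt_top {h : ι → ℝ≥0∞} (hh : ∀ i, h i < ∞) :
    ∫⁻ i, h i ∂(empirical (id : ι → ι) : Measure ι) < ∞ := by
  rw [lintegral_empirical]
  exact ENNReal.mul_lt_top (by simp [Fintype.card_pos]) (ENNReal.sum_lt_top.2 fun i _ => hh i)

/-- The particle system is the McKean-Vlasov equation on the index set with the uniform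
distribution. -/
theorem solvesParticleSystem_iff (hp : 0 ≤ p) {ζ : ι → Space d} {w x : ι → PathSpace d T} :
    SolvesParticleSystem hp b ζ w x ↔
      IsMcKeanVlasovSolution (empirical (id : ι → ι) : Measure ι) b ζ w x := by
  constructor
  · intro h
    refine ⟨.of_discrete, fun s => empiricalW p hp fun j => x j s, fun s => ?_, ae_empirical_iff.2 h⟩
    rw [map_empirical .of_discrete]
    rfl
  · rintro ⟨-, μ, hμ, h⟩
    have e : μ = fun s => empiricalW p hp fun j => x j s := by
      funext s
      refine Subtype.ext (Subtype.ext ((hμ s).trans ?_))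
      rw [map_empirical .of_discrete]
      rfl
    rw [e] at h
    exact ae_empirical_iff.1 h

theorem exists_solvesParticleSystem (hT : 0 ≤ T) (hp : 1 ≤ p) (hb : b.Admissible)
    (ζ : ι → Space d) (w : ι → PathSpace d T) :
    ∃ x, SolvesParticleSystem (zero_le_one.trans hp) b ζ w x := by
  have hp0 : 0 < p := by linarith
  simp_rw [solvesParticleSystem_iff]
  exact exists_isMcKeanVlasovSolution hT hp hb .of_discrete .of_discrete
    (lintegral_empirical_lt_top fun i => ENNReal.rpow_lt_top_of_nonneg hp0.le (by simp))
    (lintegral_empirical_lt_top fun i => ENNReal.rpow_lt_top_of_nonneg hp0.le (by simp))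

theorem SolvesParticleSystem.stability (hp : 1 ≤ p) {K : ℝ≥0} (hK : b.LipschitzBound K)
    {ζ ζ' : ι → Space d} {w w' x x' : ι → PathSpace d T}
    (h : SolvesParticleSystem (zero_le_one.trans hp) b ζ w x)
    (h' : SolvesParticleSystem (zero_le_one.trans hp) b ζ' w' x') (t : Time T) (i : ι) :
    ‖stopAt t (x i - x' i)‖ₑ ^ p ≤ stabilityConst p T K *
      (∑ j, ‖ζ j - ζ' j‖ₑ ^ p + ∑ j, ‖stopAt t (w j - w' j)‖ₑ ^ p) := by
  have hp0 : 0 < p := by linarith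
  have key := ((solvesParticleSystem_iff _).1 h).stability hp hK ((solvesParticleSystem_iff _).1 h')
    .of_discrete .of_discrete .of_discrete .of_discrete
    (lintegral_empirical_lt_top fun i => ENNReal.rpow_lt_top_of_nonneg hp0.le (by simp))
    (lintegral_empirical_lt_top fun i => ENNReal.rpow_lt_top_of_nonneg hp0.le (by simp))
    (lintegral_empirical_lt_top fun i => ENNReal.rpow_lt_top_of_nonneg hp0.le (by simp))
    (lintegral_empirical_lt_top fun i => ENNReal.rpow_lt_top_of_nonneg hp0.le (by simp)) t
  -- The factor `1/N` cancels, and a single particle is then bounded by the sum over all.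
  rw [lintegral_empirical, lintegral_empirical, lintegral_empirical, ← mul_add,
    mul_left_comm, ENNReal.mul_le_mul_iff_right (by simp) (by simp)] at key
  exact (Finset.single_le_sum (f := fun j => ‖stopAt t (x j - x' j)‖ₑ ^ p) (fun _ _ => zero_le)
    (Finset.mem_univ i)).trans key

theorem SolvesParticleSystem.stop_eq (hp : 1 ≤ p) (hb : b.Admissible)
    {ζ : ι → Space d} {w w' x x' : ι → PathSpace d T}
    (h : SolvesParticleSystem (zero_le_one.trans hp) b ζ w x)
    (h' : SolvesParticleSystem (zero_le_one.trans hp) b ζ w' x') {t : Time T}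
    (hww' : ∀ i, stopAt t (w i) = stopAt t (w' i)) (i : ι) : stopAt t (x i) = stopAt t (x' i) := by
  obtain ⟨K, hK⟩ : ∃ K, b.LipschitzBound K := hb.lipschitz
  have hp0 : 0 < p := by linarith
  have key := h.stability hp hK h' t i
  have hz : ∀ j, ‖stopAt t (w j - w' j)‖ₑ ^ p = 0 := fun j => by
    rw [stopAt_sub, hww', ← stopAt_sub, sub_self, enorm_stopAt_zero, ENNReal.zero_rpow_of_pos hp0]
  simp only [hz, sub_self, enorm_zero, ENNReal.zero_rpow_of_pos hp0, Finset.sum_const_zero,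
    add_zero, mul_zero, nonpos_iff_eq_zero, ENNReal.rpow_eq_zero_iff_of_pos hp0] at key
  ext1 s
  have := enorm_apply_le (stopAt t (x i - x' i)) s
  rw [key, nonpos_iff_eq_zero, enorm_eq_zero] at this
  exact sub_eq_zero.1 this

theorem SolvesParticleSystem.unique (hT : 0 ≤ T) (hp : 1 ≤ p) (hb : b.Admissible)
    {ζ : ι → Space d} {w x x' : ι → PathSpace d T}
    (h : SolvesParticleSystem (zero_le_one.trans hp) b ζ w x)
    (h' : SolvesParticleSystem (zero_le_one.trans hp) b ζ w x') : x = x' := by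
  funext i
  have := h.stop_eq hp hb h' (t := finalTime hT) (fun _ => rfl) i
  rwa [stopAt_finalTime, stopAt_finalTime] at this

/-- The solution of the particle system depends continuously on the inputs. -/
theorem exists_continuous_solvesParticleSystem (hT : 0 ≤ T) (hp : 1 ≤ p) (hb : b.Admissible) :
    ∃ Ψ : (ι → Space d) × (ι → PathSpace d T) → ι → PathSpace d T, Continuous Ψ ∧
      ∀ z, SolvesParticleSystem (zero_le_one.trans hp) b z.1 z.2 (Ψ z) := by
  obtain ⟨K, hK⟩ : ∃ K, b.LipschitzBound K := hb.lipschitz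
  have hp0 : 0 < p := by linarith
  choose Ψ hΨ using fun z : (ι → Space d) × (ι → PathSpace d T) =>
    exists_solvesParticleSystem hT hp hb z.1 z.2
  refine ⟨Ψ, continuous_pi fun i => continuous_iff_continuousAt.2 fun z₀ => ?_, hΨ⟩
  refine tendsto_iff_edist_tendsto_0.2 ?_
  set G : (ι → Space d) × (ι → PathSpace d T) → ℝ≥0∞ := fun z =>
    (stabilityConst p T K * (∑ j, ‖z.1 j - z₀.1 j‖ₑ ^ p + ∑ j, ‖z.2 j - z₀.2 j‖ₑ ^ p)) ^ p⁻¹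
    with hG
  have hGc : Continuous G := by
    refine ENNReal.continuous_rpow_const.comp
      ((ENNReal.continuous_const_mul (stabilityConst_ne_top hp0.le K)).comp (.add ?_ ?_))
    · exact continuous_finsetSum _ fun j _ => ENNReal.continuous_rpow_const.comp (by fun_prop)
    · exact continuous_finsetSum _ fun j _ => ENNReal.continuous_rpow_const.comp (by fun_prop)
  have hG0 : Tendsto G (𝓝 z₀) (𝓝 0) := by
    have := hGc.tendsto z₀
    have e : G z₀ = 0 := by
      have hz (j : ι) : ‖z₀.2 j - z₀.2 j‖ₑ ^ p = 0 := by
        rw [← edist_eq_enorm_sub, edist_self, ENNReal.zero_rpow_of_pos hp0]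
      simp only [hG, hz]
      simp [hp0]
    rwa [e] at this
  refine tendsto_of_tendsto_of_tendsto_of_le_of_le tendsto_const_nhds hG0 (fun _ => zero_le)
    fun z => ?_
  rw [hG, ENNReal.le_rpow_inv_iff hp0, edist_eq_enorm_sub]
  have := (hΨ z).stability hp hK (hΨ z₀) (finalTime hT) i
  simpa only [stopAt_finalTime] using this

variable {Ω : Type*} {m : MeasurableSpace Ω}

theorem measurable_of_solvesParticleSystem (hT : 0 ≤ T) (hp : 1 ≤ p) (hb : b.Admissible)
    {ζ : ι → Ω → Space d} {W : ι → Ω → PathSpace d T} {X : Ω → ι → PathSpace d T}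
    (hζ : ∀ i, Measurable (ζ i)) (hW : ∀ i, Measurable (W i))
    (hX : ∀ ω, SolvesParticleSystem (zero_le_one.trans hp) b (fun i => ζ i ω) (fun i => W i ω)
      (X ω)) : Measurable X := by
  obtain ⟨Ψ, hΨc, hΨ⟩ := exists_continuous_solvesParticleSystem (ι := ι) hT hp hb
  have e : X = fun ω => Ψ (fun i => ζ i ω, fun i => W i ω) := by
    funext ω
    exact (hX ω).unique hT hp hb (hΨ (fun i => ζ i ω, fun i => W i ω))
  rw [e]
  exact hΨc.measurable.comp ((measurable_pi_lambda _ hζ).prodMk (measurable_pi_lambda _ hW))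

/-- At time `t` the solution equals the one with noise stopped at `t`, for every `ω`; the latter is
a continuous function of `ℱ t`-measurable inputs. -/
theorem isStronglyProgressive_of_solvesParticleSystem (hp : 1 ≤ p) (hb : b.Admissible)
    {ζ : ι → Ω → Space d} {W : ι → Ω → PathSpace d T} {X : Ω → ι → PathSpace d T}
    {ℱ : Filtration (Time T) m} (hin : ∀ i, AdaptedInput ℱ (ζ i) (W i))
    (hX : ∀ ω, SolvesParticleSystem (zero_le_one.trans hp) b (fun i => ζ i ω) (fun i => W i ω)
      (X ω)) : IsStronglyProgressive ℱ fun t ω i => X ω i t := by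
  refine StronglyAdapted.isStronglyProgressive_of_continuous (fun t => ?_)
    fun ω => continuous_pi fun i => (X ω i).continuous
  refine Measurable.stronglyMeasurable (?_ : Measurable[ℱ t] fun ω i => X ω i t)
  have hT : 0 ≤ T := t.2.1.trans t.2.2
  choose Y hY using fun ω => exists_solvesParticleSystem hT hp hb (fun i => ζ i ω)
    fun i => stopAt t (W i ω)
  have e : (fun ω i => X ω i t) = fun ω i => Y ω i t := by
    funext ω i
    have h := (hX ω).stop_eq hp hb (hY ω) (t := t) (fun j => (stopAt_stopAt t (W j ω)).symm) i
    simpa using DFunLike.congr_fun h t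
  rw [e]
  exact measurable_eval_pi (measurable_of_solvesParticleSystem (m := ℱ t) hT hp hb
    (fun i => (hin i).measurable_init t) (fun i => (hin i).measurable_stopAt t) hY) t

end ParticleSystem

/-! ### Convergence of the empirical measures. -/

section Convergence

theorem enorm_fst_le {E F : Type*} [NormedAddCommGroup E] [NormedAddCommGroup F] (u : E × F) :
    ‖u.1‖ₑ ≤ ‖u‖ₑ := by
  rw [← ofReal_norm, ← ofReal_norm]
  exact ENNReal.ofReal_le_ofReal (norm_fst_le u)

theorem enorm_snd_le {E F : Type*} [NormedAddCommGroup E] [NormedAddCommGroup F] (u : E × F) :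
    ‖u.2‖ₑ ≤ ‖u‖ₑ := by
  rw [← ofReal_norm, ← ofReal_norm]
  exact ENNReal.ofReal_le_ofReal (norm_snd_le u)

theorem enorm_integral_map_sub_rpow_le {Ω E : Type*} {m : MeasurableSpace Ω} {P : Measure Ω}
    [IsProbabilityMeasure P] [NormedAddCommGroup E] [MeasurableSpace E] [BorelSpace E]
    [SecondCountableTopology E] (hp : 1 ≤ p) {A B : Ω → E} (hA : Measurable A) (hB : Measurable B)
    {f : E → ℝ} (hfb : ∃ C : ℝ, ∀ x y, dist (f x) (f y) ≤ C) {L : ℝ≥0} (hL : LipschitzWith L f) :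
    ‖∫ x, f x ∂(P.map A) - ∫ x, f x ∂(P.map B)‖ₑ ^ p ≤ L ^ p * ∫⁻ ω, ‖A ω - B ω‖ₑ ^ p ∂P := by
  have hp0 : 0 < p := by linarith
  have hf : Measurable f := hL.continuous.measurable
  obtain ⟨C, hC⟩ := hfb
  have hint {A : Ω → E} (hA : Measurable A) : Integrable (fun ω => f (A ω)) P := by
    refine Integrable.of_bound (hf.comp hA).aestronglyMeasurable (C + ‖f 0‖)
      (Eventually.of_forall fun ω => ?_)
    have h1 := hC (A ω) 0
    rw [dist_eq_norm] at h1
    linarith [norm_le_norm_sub_add (f (A ω)) (f 0)]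
  rw [integral_map hA.aemeasurable hf.aestronglyMeasurable,
    integral_map hB.aemeasurable hf.aestronglyMeasurable, ← integral_sub (hint hA) (hint hB)]
  calc ‖∫ ω, (f (A ω) - f (B ω)) ∂P‖ₑ ^ p ≤ (∫⁻ ω, L * ‖A ω - B ω‖ₑ ∂P) ^ p := by
        gcongr
        refine (enorm_integral_le_lintegral_enorm _).trans (lintegral_mono fun ω => ?_)
        rw [← edist_eq_enorm_sub, ← edist_eq_enorm_sub]
        exact hL _ _
    _ = L ^ p * (∫⁻ ω, ‖A ω - B ω‖ₑ ∂P) ^ p := by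
        rw [lintegral_const_mul' _ _ (by simp), ENNReal.mul_rpow_of_nonneg _ _ hp0.le]
    _ ≤ _ := by
        gcongr
        refine (lintegral_enorm_rpow_le hp (hA.sub hB).aestronglyMeasurable).trans_eq ?_
        rw [measure_univ, ENNReal.one_rpow, one_mul]
        rfl

variable {Ω : Type*} {m : MeasurableSpace Ω} {P : Measure Ω} [IsProbabilityMeasure P]
  {b : Drift d T p} {ι : Type*} [Fintype ι] [Nonempty ι] [MeasurableSpace ι]
  [DiscreteMeasurableSpace ι]

/-- The distance between a solution of the particle system and a solution of the McKean-Vlasov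
equation, under a coupling of the uniform distribution on the particles and the underlying
probability measure. -/
theorem SolvesParticleSystem.lintegral_sub_le (hT : 0 ≤ T) (hp : 1 ≤ p) {K : ℝ≥0}
    (hK : b.LipschitzBound K) {ζ : ι → Space d} {w x : ι → PathSpace d T}
    (h : SolvesParticleSystem (zero_le_one.trans hp) b ζ w x)
    {ζ' : Ω → Space d} {W' Y : Ω → PathSpace d T} (hY : IsMcKeanVlasovSolution P b ζ' W' Y)
    (hζ' : Measurable ζ') (hW' : Measurable W')
    (hζp : ∫⁻ ω, ‖ζ' ω‖ₑ ^ p ∂P < ∞) (hWp : ∫⁻ ω, ‖W' ω‖ₑ ^ p ∂P < ∞)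
    {π : Measure (ι × Ω)} (hπ₁ : π.map Prod.fst = (empirical (id : ι → ι) : Measure ι))
    (hπ₂ : π.map Prod.snd = P) :
    ∫⁻ z, ‖x z.1 - Y z.2‖ₑ ^ p ∂π ≤ stabilityConst p T K *
      (2 * ∫⁻ z, ‖((ζ z.1, w z.1) : Space d × PathSpace d T) - (ζ' z.2, W' z.2)‖ₑ ^ p ∂π) := by
  have hp0 : 0 < p := by linarith
  have hprob : IsProbabilityMeasure π := by
    refine ⟨?_⟩
    rw [← Set.preimage_univ (f := (Prod.snd : ι × Ω → Ω)),
      ← Measure.map_apply measurable_snd MeasurableSet.univ, hπ₂, measure_univ]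
  -- Under `π` the projections are measure preserving, so both solutions live on `ι × Ω`.
  have h1 := ((solvesParticleSystem_iff _).1 h).comp (φ := Prod.fst) ⟨measurable_fst, hπ₁⟩
  have h2 := hY.comp (φ := Prod.snd) ⟨measurable_snd, hπ₂⟩
  have hdisc {E : Type} [NormedAddCommGroup E] (v : ι → E) :
      ∫⁻ z, ‖(v ∘ Prod.fst) z‖ₑ ^ p ∂π < ∞ := by
    refine (lintegral_comp_fst_of_map_eq hπ₁ (f := fun i => ‖v i‖ₑ ^ p) .of_discrete).trans_lt ?_
    exact lintegral_empirical_lt_top fun i => ENNReal.rpow_lt_top_of_nonneg hp0.le (by simp)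
  have key := h1.stability hp hK h2 (Measurable.of_discrete.comp measurable_fst)
    (hζ'.comp measurable_snd) (Measurable.of_discrete.comp measurable_fst)
    (hW'.comp measurable_snd) (hdisc ζ)
    ((lintegral_comp_snd_of_map_eq hπ₂ (hζ'.enorm.pow_const p)).trans_lt hζp) (hdisc w)
    ((lintegral_comp_snd_of_map_eq hπ₂ (hW'.enorm.pow_const p)).trans_lt hWp) (finalTime hT)
  simp only [stopAt_finalTime, Function.comp_apply] at key
  refine key.trans ?_
  -- The factor `2` pays for bounding both components by the norm of the pair.
  rw [two_mul]
  gcongr with z z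
  · exact enorm_fst_le ((ζ z.1, w z.1) - (ζ' z.2, W' z.2))
  · exact enorm_snd_le ((ζ z.1, w z.1) - (ζ' z.2, W' z.2))

/-- The particle inputs are deterministic here; chance enters only through `hconv`. Weak convergence
is tested on bounded Lipschitz functions, whose integrals a coupling controls. -/
theorem tendsto_empirical_of_solvesParticleSystem (hT : 0 ≤ T) (hp : 1 ≤ p) (hb : b.Admissible)
    {ζ : ℕ → Space d} {w : ℕ → PathSpace d T} {x : (N : ℕ) → Fin (N + 1) → PathSpace d T}
    (hx : ∀ N, SolvesParticleSystem (zero_le_one.trans hp) b (fun i : Fin (N + 1) => ζ i)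
      (fun i => w i) (x N))
    {ζ' : Ω → Space d} {W' Y : Ω → PathSpace d T} (hY : IsMcKeanVlasovSolution P b ζ' W' Y)
    (hζ' : Measurable ζ') (hW' : Measurable W')
    (hζp : ∫⁻ ω, ‖ζ' ω‖ₑ ^ p ∂P < ∞) (hWp : ∫⁻ ω, ‖W' ω‖ₑ ^ p ∂P < ∞)
    (hconv : ∀ ε : ℝ≥0∞, 0 < ε → ∀ᶠ N in atTop, ∃ π : Measure (Fin (N + 1) × Ω),
      π.map Prod.fst = (empirical (id : Fin (N + 1) → Fin (N + 1)) : Measure (Fin (N + 1))) ∧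
      π.map Prod.snd = P ∧
      ∫⁻ z, ‖((ζ z.1, w z.1) : Space d × PathSpace d T) - (ζ' z.2, W' z.2)‖ₑ ^ p ∂π ≤ ε) :
    Tendsto (fun N => empirical (x N)) atTop
      (𝓝 ⟨P.map Y, Measure.isProbabilityMeasure_map hY.measurable.aemeasurable⟩) := by
  have hp0 : 0 < p := by linarith
  obtain ⟨K, hK⟩ : ∃ K, b.LipschitzBound K := hb.lipschitz
  refine tendsto_iff_forall_lipschitz_integral_tendsto.2 fun f hfb ⟨L, hL⟩ => ?_
  refine tendsto_iff_edist_tendsto_0.2 (ENNReal.tendsto_nhds_zero.2 fun ε hε => ?_)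
  set c : ℝ≥0∞ := L ^ p * (stabilityConst p T K * 2) with hc
  have hctop : c ≠ ∞ := ENNReal.mul_ne_top (ENNReal.rpow_ne_top_of_nonneg hp0.le (by simp))
    (ENNReal.mul_ne_top (stabilityConst_ne_top hp0.le K) (by simp))
  have hlim : Tendsto (fun δ : ℝ≥0∞ => c * δ) (𝓝[>] 0) (𝓝 0) := by
    have := ((ENNReal.continuous_const_mul hctop).tendsto 0).mono_left
      (nhdsWithin_le_nhds (s := Set.Ioi 0))
    rwa [mul_zero] at this
  have hε' : 0 < ε ^ p := by
    rcases eq_or_ne ε ∞ with rfl | h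
    · simp [hp0]
    · exact ENNReal.rpow_pos hε h
  obtain ⟨δ, hδ, hδ0⟩ := ((hlim.eventually_le_const hε').and self_mem_nhdsWithin).exists
  filter_upwards [hconv δ hδ0] with N ⟨π, hπ₁, hπ₂, hπ⟩
  have hprob : IsProbabilityMeasure π := by
    refine ⟨?_⟩
    rw [← Set.preimage_univ (f := (Prod.snd : Fin (N + 1) × Ω → Ω)),
      ← Measure.map_apply measurable_snd MeasurableSet.univ, hπ₂, measure_univ]
  have hxm : Measurable (x N) := .of_discrete
  have e₁ : (empirical (x N) : Measure (PathSpace d T)) = π.map fun z => x N z.1 := by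
    rw [← map_empirical hxm, ← hπ₁, Measure.map_map hxm measurable_fst]
    rfl
  have e₂ : P.map Y = π.map fun z => Y z.2 := by
    conv_lhs => rw [← hπ₂]
    rw [Measure.map_map hY.measurable measurable_snd]
    rfl
  rw [← ENNReal.rpow_le_rpow_iff hp0, edist_eq_enorm_sub, ProbabilityMeasure.coe_mk, e₁, e₂]
  refine (enorm_integral_map_sub_rpow_le hp (hxm.comp measurable_fst)
    (hY.measurable.comp measurable_snd) hfb hL).trans (le_trans ?_ hδ)
  rw [hc, mul_assoc, mul_assoc]
  gcongr
  refine ((hx N).lintegral_sub_le hT hp hK hY hζ' hW' hζp hWp hπ₁ hπ₂).trans ?_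
  gcongr

end Convergence

end MeanField

end

/-! ### The main theorem. -/

open MeanField in
theorem corollary3p4 {d : ℕ} {T p : ℝ} (hT : 0 < T) (hp : 1 < p)
    {b : Drift d T p} (hb : b.Admissible)
    {Ω : Type*} {m : MeasurableSpace Ω} {P : Measure Ω} [IsProbabilityMeasure P]
    {ℱ : Filtration (Time T) m} (hℱ : UsualConditions P ℱ)
    {ζ : ℕ → Ω → Space d} {W : ℕ → Ω → PathSpace d T}
    (hζ : ∀ i, MemLp (ζ i) (ENNReal.ofReal p) P)
    (hW : ∀ i, IsBrownianMotion P (W i))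
    (hadapted : ∀ i, AdaptedInput ℱ (ζ i) (W i))
    (hindep : iIndepFun (fun i ω => (ζ i ω, W i ω)) P)
    {ζ' : Ω → Space d} {W' : Ω → PathSpace d T} (hζ' : Measurable ζ') (hW' : Measurable W')
    (hLp : MemLp (fun ω => (ζ' ω, W' ω)) (ENNReal.ofReal p) P)
    (hident : ∀ i, IdentDistrib (fun ω => (ζ i ω, W i ω)) (fun ω => (ζ' ω, W' ω)) P P) :
    -- the particle system with `N + 1` particles has exactly one solution for every `ω`
    (∀ (N : ℕ) (ω : Ω), ∃! x : Fin (N + 1) → PathSpace d T,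
      SolvesParticleSystem (zero_le_one.trans hp.le) b (fun i : Fin (N + 1) => ζ i ω) (fun i => W i ω) x) ∧
    -- the McKean-Vlasov equation has a solution, unique up to almost sure equality
    (∃ Y, IsMcKeanVlasovSolution P b ζ' W' Y) ∧
    (∀ Y Y', IsMcKeanVlasovSolution P b ζ' W' Y → IsMcKeanVlasovSolution P b ζ' W' Y' →
      Y =ᵐ[P] Y') ∧
    -- measurability of the solutions, and convergence of the empirical measures
    ∀ X : (N : ℕ) → Ω → Fin (N + 1) → PathSpace d T,
      (∀ N ω, SolvesParticleSystem (zero_le_one.trans hp.le) b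
        (fun i : Fin (N + 1) => ζ i ω) (fun i => W i ω) (X N ω)) →
      ∀ (Y : Ω → PathSpace d T) (hY : IsMcKeanVlasovSolution P b ζ' W' Y),
        (∀ N, Measurable (X N)) ∧
        (∀ N, IsStronglyProgressive ℱ fun t ω (i : Fin (N + 1)) => X N ω i t) ∧
        (∀ 𝒢 : Filtration (Time T) m, UsualConditions P 𝒢 → AdaptedInput 𝒢 ζ' W' →
          IsStronglyProgressive 𝒢 fun t ω => Y ω t) ∧
        ∀ᵐ ω ∂P, Tendsto (fun N => empirical (X N ω)) atTop
          (𝓝 ⟨P.map Y, Measure.isProbabilityMeasure_map hY.measurable.aemeasurable⟩) := by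
  have hp1 : 1 ≤ p := hp.le
  have hp0 : 0 < p := by linarith
  have hZ'p := (memLp_ofReal_iff hp0 (hζ'.prodMk hW')).1 hLp
  have hζ'p : ∫⁻ ω, ‖ζ' ω‖ₑ ^ p ∂P < ∞ := lt_of_le_of_lt
    (lintegral_mono fun ω => ENNReal.rpow_le_rpow (enorm_fst_le (ζ' ω, W' ω)) hp0.le) hZ'p
  have hW'p : ∫⁻ ω, ‖W' ω‖ₑ ^ p ∂P < ∞ := lt_of_le_of_lt
    (lintegral_mono fun ω => ENNReal.rpow_le_rpow (enorm_snd_le (ζ' ω, W' ω)) hp0.le) hZ'p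
  -- Membership in `L^p` gives only almost everywhere measurability; adaptedness gives the genuine
  -- one.
  have hζm (i : ℕ) : Measurable (ζ i) :=
    ((hadapted i).measurable_init (finalTime hT.le)).mono (ℱ.le _) le_rfl
  refine ⟨fun N ω => ?_, exists_isMcKeanVlasovSolution hT.le hp1 hb hζ' hW' hζ'p hW'p,
    fun Y Y' hY hY' => hY.ae_eq hT.le hp1 hb hY' hζ' hW' hζ'p hW'p, fun X hX Y hY =>
    ⟨fun N => ?_, fun N => ?_, fun 𝒢 h𝒢 hin => ?_, ?_⟩⟩
  · obtain ⟨x, hx⟩ := exists_solvesParticleSystem (ι := Fin (N + 1)) hT.le hp1 hb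
      (fun i : Fin (N + 1) => ζ i ω) (fun i : Fin (N + 1) => W i ω)
    exact ⟨x, hx, fun y hy => SolvesParticleSystem.unique hT.le hp1 hb hy hx⟩
  · exact measurable_of_solvesParticleSystem hT.le hp1 hb (fun i => hζm i)
      (fun i => (hW i).measurable) (hX N)
  · exact isStronglyProgressive_of_solvesParticleSystem hp1 hb (fun i => hadapted i) (hX N)
  · exact hY.isStronglyProgressive hp1 hb hζ' hW' hζ'p hW'p h𝒢.2 hin
  · filter_upwards [ae_eventually_exists_coupling hp1 hindep hident (hζ'.prodMk hW') hZ'p] with ω hω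
    exact tendsto_empirical_of_solvesParticleSystem (ζ := fun i => ζ i ω) (w := fun i => W i ω)
      hT.le hp1 hb (fun N => hX N ω) hY hζ' hW' hζ'p hW'p hω
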